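/- Let $G$ be a finite simple graph on $n$ vertices. A fall coloring of $G$ with $k$ colors is a partition of $V(G)$ into $k$ (nonempty) independent dominating sets; the problem Fall Coloring asks, given $G$ and $k$, whether $G$ has a fall coloring with $k$ colors. A rooted branch decomposition of $G$ is a pair $(T,\mathcal L)$ of a rooted tree $T$ of maximum degree at most three and a bijection $\mathcal L$ from $V(G)$ to the set of leaves of $T$ (the nodes of degree one; the only node of a one-node tree is a leaf as well). For a node $t$ of $T$, let $V_t$ be the set of vertices $v$ such that $\mathcal L(v)$ lies in the subtree of $T$ rooted at $t$, and for $u,v\in V_t$ let $u\sim_t v$ if and only if $N_G(u)\setminus V_t=N_G(v)\setminus V_t$. The module-width of $(T,\mathcal L)$ is $w=\max_{t\in V(T)}|V_t/{\sim_t}|$. **Theorem.** There are an algorithm and a constant $c\in\mathbb N$ such that, given a graph $G$ on $n$ vertices, a rooted branch decomposition $(T,\mathcal L)$ of $G$ with $N=|V(T)|$ nodes and module-width $w$, and a number $k\in\mathbb N$, the algorithm decides in at most $$c\cdot N^{c}\cdot n^{2^{c\,w}}$$ steps whether $G$ has a fall coloring with $k$ colors. In particular, if $N=O(n)$ (which always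 holds when no node of $T$ other than the root has degree two, since then $N\le 2n$), Fall Coloring is solved in time $n^{2^{O(w)}}$ for $n\ge 2$. Here the algorithm is one fixed program of a unit-cost random access machine working on natural numbers, whose elementary operations are constants, reading and writing memory cells with computed addresses, addition, truncated subtraction, and tests for zero (no multiplication); the input consists of $n$, $k$, $N$, the adjacency matrix of $G$, the root and the parent of each node of $T$, and the leaf $\mathcal L(v)$ of each vertex $v$. -/

import Mathlib

/-! ### Fall colorings -/

/-- `S` is a dominating set of `G`: every vertex outside `S` has a neighbour in `S`. -/
def IsDominatingSet {V : Type*} (G : SimpleGraph V) (S : Set V) : Prop :=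
  ∀ v, v ∉ S → ∃ u ∈ S, G.Adj v u

/-- `G` has a fall coloring with `k` colors: its vertex set can be partitioned into `k`
(nonempty) independent dominating sets, the fibres of `φ`. -/
def HasFallColoring {V : Type*} (G : SimpleGraph V) (k : ℕ) : Prop :=
  ∃ φ : V → Fin k, ∀ i : Fin k,
    (φ ⁻¹' {i}).Nonempty ∧ G.IsIndepSet (φ ⁻¹' {i}) ∧ IsDominatingSet G (φ ⁻¹' {i})

/-! ### Rooted branch decompositions and module-width -/

/-- A rooted tree on the node set `τ`, given by its parent map (with the convention that the
root is its own parent): following parents, every node reaches the root. -/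
structure RootedTreeOn (τ : Type*) where
  root : τ
  parent : τ → τ
  parent_root : parent root = root
  reaches_root : ∀ t, ∃ i : ℕ, parent^[i] t = root

namespace RootedTreeOn

variable {τ : Type*} (T : RootedTreeOn τ)

/-- The neighbours of `t` in the tree: its children and, if `t` is not the root, its parent. -/
def neighbors (t : τ) : Set τ := {s | s ≠ t ∧ (T.parent s = t ∨ T.parent t = s)}

noncomputable def degree (t : τ) : ℕ := (T.neighbors t).ncard

def IsSubcubic : Prop := ∀ t, T.degree t ≤ 3

/-- A leaf is a node of degree one; the only node of a one-node tree is a leaf as well. -/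
def IsLeaf (t : τ) : Prop := T.degree t ≤ 1

/-- The node set of the subtree rooted at `t`: all descendants of `t`, including `t`. -/
def subtree (t : τ) : Set τ := {s | ∃ i : ℕ, T.parent^[i] s = t}

end RootedTreeOn

/-- A rooted branch decomposition of a graph with vertex set `V`: a rooted subcubic tree together
with a bijection from `V` to the leaves of the tree. -/
structure RootedBranchDecomposition (V τ : Type*) where
  tree : RootedTreeOn τ
  subcubic : tree.IsSubcubic
  leafEquiv : V ≃ {t : τ // tree.IsLeaf t}

namespace RootedBranchDecomposition

variable {V τ : Type*} (D : RootedBranchDecomposition V τ)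

/-- `V_t`: the vertices that are mapped to leaves in the subtree rooted at `t`. -/
def verts (t : τ) : Set V := {v | (D.leafEquiv v : τ) ∈ D.tree.subtree t}

/-- The equivalence relation `∼_t` on `V_t`: having the same neighbours outside `V_t`. -/
def nbrSetoid (G : SimpleGraph V) (t : τ) : Setoid (D.verts t) where
  r u v := G.neighborSet u ∩ (D.verts t)ᶜ = G.neighborSet v ∩ (D.verts t)ᶜ
  iseqv := ⟨fun _ => rfl, fun h => h.symm, fun h₁ h₂ => h₁.trans h₂⟩

/-- The module-width of a rooted branch decomposition of `G`: the maximum over all nodes `t`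
of the number of equivalence classes of `∼_t`. -/
noncomputable def moduleWidth [Fintype τ] (G : SimpleGraph V) : ℕ :=
  Finset.univ.sup fun t : τ => Nat.card (Quotient (D.nbrSetoid G t))

end RootedBranchDecomposition

/-! ### Random access machine programs and their running time

The memory consists of arrays (named by natural numbers, finitely many of which occur in a
program) of natural numbers. The elementary operations are constants, memory access with computed
index, addition, truncated subtraction, and the test for zero; each costs one step. There is no
multiplication, so this unit-cost model is polynomially equivalent to Turing machines. -/

/-- The memory: `σ a i` is the content of cell `i` of array `a`. -/
abbrev RamStore : Type := ℕ → ℕ → ℕ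

inductive RamExpr : Type
  | const (c : ℕ)
  | read (a : ℕ) (i : RamExpr)
  | add (e₁ e₂ : RamExpr)
  | sub (e₁ e₂ : RamExpr)

namespace RamExpr

def eval (σ : RamStore) : RamExpr → ℕ
  | const c => c
  | read a i => σ a (i.eval σ)
  | add e₁ e₂ => e₁.eval σ + e₂.eval σ
  | sub e₁ e₂ => e₁.eval σ - e₂.eval σ

/-- The number of elementary operations in the evaluation of an expression. -/
def cost : RamExpr → ℕ
  | const _ => 1
  | read _ i => i.cost + 1
  | add e₁ e₂ => e₁.cost + e₂.cost + 1
  | sub e₁ e₂ => e₁.cost + e₂.cost + 1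

end RamExpr

inductive RamProg : Type
  | skip
  /-- Store the value of `e` in the cell of array `a` whose index is the value of `i`. -/
  | write (a : ℕ) (i e : RamExpr)
  | seq (p q : RamProg)
  /-- Execute `p` if the value of `b` is nonzero and `q` otherwise. -/
  | ite (b : RamExpr) (p q : RamProg)
  /-- Execute `p` as long as the value of `b` is nonzero. -/
  | loop (b : RamExpr) (p : RamProg)

/-- `p.Runs σ σ' t`: started on memory `σ`, the program `p` halts after exactly `t` steps, with
memory `σ'`. -/
inductive RamProg.Runs : RamProg → RamStore → RamStore → ℕ → Prop
  | skip (σ : RamStore) : Runs .skip σ σ 1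
  | write (a : ℕ) (i e : RamExpr) (σ : RamStore) :
      Runs (.write a i e) σ
        (Function.update σ a (Function.update (σ a) (i.eval σ) (e.eval σ)))
        (i.cost + e.cost + 1)
  | seq {p q : RamProg} {σ σ' σ'' : RamStore} {t₁ t₂ : ℕ} :
      Runs p σ σ' t₁ → Runs q σ' σ'' t₂ → Runs (.seq p q) σ σ'' (t₁ + t₂)
  | ite_true {b : RamExpr} {p q : RamProg} {σ σ' : RamStore} {t : ℕ} :
      b.eval σ ≠ 0 → Runs p σ σ' t → Runs (.ite b p q) σ σ' (b.cost + 1 + t)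
  | ite_false {b : RamExpr} {p q : RamProg} {σ σ' : RamStore} {t : ℕ} :
      b.eval σ = 0 → Runs q σ σ' t → Runs (.ite b p q) σ σ' (b.cost + 1 + t)
  | loop_done {b : RamExpr} {p : RamProg} {σ : RamStore} :
      b.eval σ = 0 → Runs (.loop b p) σ σ (b.cost + 1)
  | loop_step {b : RamExpr} {p : RamProg} {σ σ' σ'' : RamStore} {t₁ t₂ : ℕ} :
      b.eval σ ≠ 0 → Runs p σ σ' t₁ → Runs (.loop b p) σ' σ'' t₂ →
        Runs (.loop b p) σ σ'' (b.cost + 1 + t₁ + t₂)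

open Classical in
/-- The initial memory for the instance consisting of a graph `G` on `{0, …, n - 1}`, a rooted
branch decomposition `D` of `G` with nodes `{0, …, N - 1}`, and a number `k`.
Array 0 contains `n`, `k`, `N` and the root; array 1 the adjacency matrix of `G` (row by row);
array 2 the parent of each node; array 3 the leaf assigned to each vertex of `G`. All other cells
are zero. -/
noncomputable def fallColInput {n N : ℕ} (G : SimpleGraph (Fin n))
    (D : RootedBranchDecomposition (Fin n) (Fin N)) (k : ℕ) : RamStore
  | 0, 0 => n
  | 0, 1 => k
  | 0, 2 => N
  | 0, 3 => D.tree.root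
  | 1, i => if ∃ u v : Fin n, G.Adj u v ∧ i = u * n + v then 1 else 0
  | 2, i => if h : i < N then D.tree.parent ⟨i, h⟩ else 0
  | 3, i => if h : i < n then (D.leafEquiv ⟨i, h⟩ : Fin N) else 0
  | _, _ => 0

/-! Fall colorings by dynamic programming over a branch decomposition.

Fix a node `t`. A color class `S` restricted to `V_t` matters for the rest of the graph only through
its *type*: the set of classes of `∼_t` that it meets, and the set of classes that contain a vertex
of `V_t` neither in `S` nor adjacent to it (`Inst.typ`). There are at most `4 ^ w` types, and a
proper coloring of `V_t` is summarized by the multiset of the types of its `k` color classes, coded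
as the sum of the powers `(n + 1) ^ type` (`code`, `Inst.Good`). As only `k ≤ n` matters, the code
determines the multiset (`exists_perm_of_code_eq`).

Each `V_t` is the disjoint union of at most three parts, namely the sets `V_c` of the children and
possibly the vertex of the leaf `t` (`ind_mem_eq_sum`); missing parts are taken to be empty. The
types of a color class in the three parts determine its type in `V_t` and whether it is independent
(`Inst.typ_eq_res`, `Inst.allowed_iff`), because the neighbors of a vertex outside a part depend
only on its class. So the multisets that occur at `t` are obtained from the multisets of triples of
types whose marginals occur at the parts: given such a multiset, colorings of the parts are combined
after permuting their colors (`Inst.good_of_merge`, `Inst.exists_merge_of_good`). The algorithm fills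
a table of the codes that occur, by repeatedly trying all nodes, all triples of parts, and all
multisets of triples, of which there are at most `(n + 1) ^ 2 ^ (6 * w)`
(`Inst.Valid.table_iff`). A fall coloring is a coloring of the whole graph all of whose types have an
empty second component, which means that its code is less than `(n + 1) ^ 2 ^ w`
(`Inst.Valid.exists_good_iff`).

For the running time, all loops of the program run up to one common bound `B`, kept in a fixed memory
cell. A program of fixed loop depth then automatically takes time polynomial in `B`, and the
predicate `Comp` of being computable in this way is closed under arithmetic, bounded sums and bounded
quantifiers, so that the computability of the criterion for a table entry follows along its
definition (`CompP.guard`, `Act.table`). The program first computes `w` with loops up to `O(n + N)`,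
then `2 ^ (6 * w)`, then the final bound `B`, which is the sum of `8 * (n + N + 1)`, `2 ^ (6 * w)` and
`(n + 1) ^ 2 ^ (6 * w)` (`stage_prepare`, `prepare_bound`), and then the table.
-/

/-! ### Contexts and computability with a common loop bound -/

namespace FallRam

/-- The memory `σ` presents the data `e`: the two agree on every array except array `4`, which
holds variables and intermediate results, and on cell `0` of array `4`, the common bound of all
loops. -/
def Presents (e σ : RamStore) : Prop := (∀ a, a ≠ 4 → σ a = e a) ∧ σ 4 0 = e 4 0

/-- A context for programs: `V` is the type of values of the variables that are in scope. -/
structure Ctx (V : Type) where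
  /-- `ok d rep`: the variables may be represented by `rep` in the cells of array `4`
  below cell `d`. -/
  ok : ℕ → (V → (ℕ → ℕ) → Prop) → Prop
  /-- What is known of the data and the variables. -/
  inv : RamStore → V → Prop
  pos : ∀ {d rep}, ok d rep → 0 < d
  mono : ∀ {d d' rep}, ok d rep → d ≤ d' → ok d' rep
  stable : ∀ {d rep}, ok d rep → ∀ {v m m'}, rep v m → (∀ i < d, m' i = m i) → rep v m'
  inv_table : ∀ {e v} (F : ℕ → ℕ), inv e v → inv (Function.update e 5 F) v

/-- The context without variables, in which the data satisfy `I`. -/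
def Ctx.base (I : RamStore → Prop) (hI : ∀ e F, I e → I (Function.update e 5 F)) : Ctx Unit where
  ok d rep := 0 < d ∧ rep = fun _ _ => True
  inv e _ := I e
  pos h := h.1
  mono h h' := ⟨h.1.trans_le h', h.2⟩
  stable := by rintro d rep ⟨_, rfl⟩; intros; trivial
  inv_table F h := hI _ F h

/-- The context with one more variable, of which `Q` is known. -/
def Ctx.ext {V : Type} (Γ : Ctx V) (Q : RamStore → V → ℕ → Prop)
    (hQ : ∀ e F v i, Q e v i → Q (Function.update e 5 F) v i) : Ctx (V × ℕ) where
  ok d rep := ∃ d' r l, Γ.ok d' r ∧ d' ≤ l ∧ l < d ∧ rep = fun x m => r x.1 m ∧ m l = x.2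
  inv e x := Γ.inv e x.1 ∧ Q e x.1 x.2
  pos := by rintro d rep ⟨d', r, l, _, _, h, _⟩; omega
  mono := by
    rintro d d' rep ⟨d₀, r, l, h₁, h₂, h₃, h₄⟩ h
    exact ⟨d₀, r, l, h₁, h₂, h₃.trans_le h, h₄⟩
  stable := by
    rintro d rep ⟨d₀, r, l, h₁, h₂, h₃, rfl⟩ v m m' ⟨h₄, h₅⟩ h
    exact ⟨Γ.stable h₁ h₄ fun i hi => h i (by omega), by rw [h l h₃, h₅]⟩
  inv_table F h := ⟨Γ.inv_table F h.1, hQ _ F _ _ h.2⟩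

/-- The extension by a loop variable, which is below the common loop bound. -/
abbrev Ctx.loop {V : Type} (Γ : Ctx V) : Ctx (V × ℕ) :=
  Γ.ext (fun e _ i => i < e 4 0) (fun e F v i h => by simpa using h)

/-- The extension by an accumulator, of which nothing is known. -/
abbrev Ctx.acc {V : Type} (Γ : Ctx V) : Ctx (V × ℕ) :=
  Γ.ext (fun _ _ _ => True) (fun _ _ _ _ h => h)

/-- `f` is computable in the context `Γ` in time polynomial in the loop bound: whatever the
location of the variables, there is a program that leaves the value in cell `d` and changes no
cell below it. -/
def Comp {V : Type} (Γ : Ctx V) (f : RamStore → V → ℕ) : Prop :=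
  ∀ d rep, Γ.ok d rep → ∃ (p : RamProg) (C : ℕ), ∀ e v σ, Γ.inv e v → Presents e σ →
    rep v (σ 4) → ∃ σ' t, p.Runs σ σ' t ∧ t ≤ C * (e 4 0 + 1) ^ C ∧ Presents e σ' ∧
      (∀ i < d, σ' 4 i = σ 4 i) ∧ σ' 4 d = f e v

/-- Time bounds have the form `C * (B + 1) ^ C`. A constant is bounded in this form. -/
theorem poly_const (c B : ℕ) : c ≤ c * (B + 1) ^ c :=
  Nat.le_mul_of_pos_right _ (by positivity)

theorem poly_add {B t₁ t₂ C₁ C₂ : ℕ} (h₁ : t₁ ≤ C₁ * (B + 1) ^ C₁)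
    (h₂ : t₂ ≤ C₂ * (B + 1) ^ C₂) : t₁ + t₂ ≤ (C₁ + C₂) * (B + 1) ^ (C₁ + C₂) := by
  have a₁ : (B + 1) ^ C₁ ≤ (B + 1) ^ (C₁ + C₂) := Nat.pow_le_pow_right (by omega) (by omega)
  have a₂ : (B + 1) ^ C₂ ≤ (B + 1) ^ (C₁ + C₂) := Nat.pow_le_pow_right (by omega) (by omega)
  rw [add_mul]
  exact add_le_add (h₁.trans (Nat.mul_le_mul_left _ a₁)) (h₂.trans (Nat.mul_le_mul_left _ a₂))

theorem poly_mul {B t C : ℕ} (h : t ≤ C * (B + 1) ^ C) :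
    B * t ≤ (C + 1) * (B + 1) ^ (C + 1) := by
  calc B * t ≤ (B + 1) * ((C + 1) * (B + 1) ^ C) :=
        Nat.mul_le_mul (by omega) (h.trans (Nat.mul_le_mul_right _ (by omega)))
    _ = _ := by ring

theorem Presents.set {e σ : RamStore} (h : Presents e σ) {d : ℕ} (hd : 0 < d) (x : ℕ) :
    Presents e (Function.update σ 4 (Function.update (σ 4) d x)) := by
  refine ⟨fun a ha => ?_, ?_⟩
  · rw [Function.update_of_ne ha, h.1 a ha]
  · rw [Function.update_self, Function.update_of_ne (by omega), h.2]

/-- A loop in which the variable at cell `l` runs through all numbers below the loop bound,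
with loop invariant `Inv`. -/
theorem runs_loop {B l K : ℕ} {body : RamProg} {Inv : ℕ → RamStore → Prop}
    (hstep : ∀ i < B, ∀ σ, Inv i σ → σ 4 l = i →
      ∃ σ' t, body.Runs σ σ' t ∧ t ≤ K ∧ Inv (i + 1) σ' ∧ σ' 4 l = i + 1)
    (hB : ∀ i σ, Inv i σ → σ 4 0 = B) {σ : RamStore} (h₀ : Inv 0 σ) (hl : σ 4 l = 0) :
    ∃ σ' t, (RamProg.loop (.sub (.read 4 (.const 0)) (.read 4 (.const l))) body).Runs σ σ' t ∧
      t ≤ B * (K + 6) + 6 ∧ Inv B σ' := by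
  have key : ∀ m i σ, i + m = B → Inv i σ → σ 4 l = i →
      ∃ σ' t, (RamProg.loop (.sub (.read 4 (.const 0)) (.read 4 (.const l))) body).Runs σ σ' t ∧
        t ≤ m * (K + 6) + 6 ∧ Inv B σ' := by
    intro m
    induction m with
    | zero =>
      intro i σ hi hI hl
      refine ⟨σ, _, .loop_done ?_, ?_, ?_⟩
      · simp only [RamExpr.eval, hB i σ hI, hl]; omega
      · simp [RamExpr.cost]
      · rwa [← hi, add_zero]
    | succ m ih =>
      intro i σ hi hI hl
      obtain ⟨σ₁, t₁, r₁, b₁, I₁, l₁⟩ := hstep i (by omega) σ hI hl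
      obtain ⟨σ₂, t₂, r₂, b₂, I₂⟩ := ih (i + 1) σ₁ (by omega) I₁ l₁
      refine ⟨σ₂, _, .loop_step ?_ r₁ r₂, ?_, I₂⟩
      · simp only [RamExpr.eval, hB i σ hI, hl]; omega
      · simp only [RamExpr.cost]
        calc _ ≤ 6 + K + (m * (K + 6) + 6) := by omega
          _ = _ := by ring
  exact key B 0 σ (by omega) h₀ hl

section Closure

variable {V : Type} {Γ : Ctx V} {f g h : RamStore → V → ℕ}

theorem Comp.congr (hf : Comp Γ f) (hfg : ∀ e v, Γ.inv e v → f e v = g e v) : Comp Γ g := by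
  intro d rep hok
  obtain ⟨p, C, hp⟩ := hf d rep hok
  refine ⟨p, C, fun e v σ hi he hv => ?_⟩
  obtain ⟨σ', t, h₁, h₂, h₃, h₄, h₅⟩ := hp e v σ hi he hv
  exact ⟨σ', t, h₁, h₂, h₃, h₄, h₅.trans (hfg e v hi)⟩

/-- Computability is inherited by every context in which the variables of `Γ` are available. -/
theorem Comp.weak {Q : RamStore → V → ℕ → Prop} {hQ} (hf : Comp Γ f) :
    Comp (Γ.ext Q hQ) (fun e x => f e x.1) := by
  rintro d rep ⟨d', r, l, h₁, h₂, h₃, rfl⟩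
  obtain ⟨p, C, hp⟩ := hf d r (Γ.mono h₁ (by omega))
  exact ⟨p, C, fun e x σ hi he hv => hp e x.1 σ hi.1 he hv.1⟩

/-- A value that is computed by a single expression. -/
theorem Comp.of_expr (E : RamExpr)
    (hE : ∀ e v σ, Presents e σ → E.eval σ = f e v) : Comp Γ f := by
  intro d rep hok
  refine ⟨.write 4 (.const d) E, E.cost + 2, fun e v σ hi he hv =>
    ⟨_, _, .write _ _ _ _, ?_, he.set (Γ.pos hok) _, ?_, ?_⟩⟩
  · refine le_trans ?_ (poly_const _ _)
    simp only [RamExpr.cost]; omega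
  · intro i hi
    simp only [RamExpr.eval, Function.update_self]
    rw [Function.update_of_ne (by omega)]
  · simp only [RamExpr.eval, Function.update_self]
    exact hE e v σ he

theorem Comp.const (c : ℕ) : Comp Γ (fun _ _ => c) :=
  .of_expr (.const c) fun _ _ _ _ => rfl

theorem Comp.bound : Comp Γ (fun e _ => e 4 0) :=
  .of_expr (.read 4 (.const 0)) fun _ _ _ h => h.2

theorem Comp.var0 {Q : RamStore → V → ℕ → Prop} {hQ} :
    Comp (Γ.ext Q hQ) (fun _ x => x.2) := by
  rintro d rep ⟨d', r, l, h₁, h₂, h₃, rfl⟩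
  refine ⟨.write 4 (.const d) (.read 4 (.const l)), 4, fun e v σ hi he hv =>
    ⟨_, _, .write _ _ _ _, ?_, he.set (Nat.zero_lt_of_lt h₃) _, ?_, ?_⟩⟩
  · exact le_trans (by simp [RamExpr.cost]) (poly_const _ _)
  · intro i hi
    simp only [RamExpr.eval, Function.update_self]
    rw [Function.update_of_ne (by omega)]
  · simp only [RamExpr.eval, Function.update_self]
    exact hv.2

/-- An elementary operation, given by an expression `E d` that reads its arguments from the
cells `d` and `d + 1`. -/
theorem Comp.op₂ (op : RamStore → ℕ → ℕ → ℕ) (E : ℕ → RamExpr)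
    (hE : ∀ d e σ, Presents e σ → (E d).eval σ = op e (σ 4 d) (σ 4 (d + 1)))
    (hf : Comp Γ f) (hg : Comp Γ g) : Comp Γ (fun e v => op e (f e v) (g e v)) := by
  intro d rep hok
  obtain ⟨p, C, hp⟩ := hf d rep hok
  obtain ⟨q, C', hq⟩ := hg (d + 1) rep (Γ.mono hok (by omega))
  refine ⟨.seq p (.seq q (.write 4 (.const d) (E d))), C + (C' + ((E d).cost + 2)),
    fun e v σ hi he hv => ?_⟩
  obtain ⟨σ₁, t₁, a₁, a₂, a₃, a₄, a₅⟩ := hp e v σ hi he hv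
  obtain ⟨σ₂, t₂, b₁, b₂, b₃, b₄, b₅⟩ := hq e v σ₁ hi a₃ (Γ.stable hok hv a₄)
  refine ⟨_, _, .seq a₁ (.seq b₁ (.write _ _ _ _)), ?_, b₃.set (Γ.pos hok) _, ?_, ?_⟩
  · refine poly_add a₂ (poly_add b₂ (le_trans ?_ (poly_const _ _)))
    simp only [RamExpr.cost]; omega
  · intro i hi
    simp only [RamExpr.eval, Function.update_self]
    rw [Function.update_of_ne (by omega), b₄ i (by omega), a₄ i hi]
  · simp only [RamExpr.eval, Function.update_self]
    rw [hE d e σ₂ b₃, b₅, b₄ d (by omega), a₅]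

theorem Comp.add (hf : Comp Γ f) (hg : Comp Γ g) : Comp Γ (fun e v => f e v + g e v) :=
  .op₂ (fun _ a b => a + b) (fun d => .add (.read 4 (.const d)) (.read 4 (.const (d + 1))))
    (fun _ _ _ _ => rfl) hf hg

theorem Comp.sub (hf : Comp Γ f) (hg : Comp Γ g) : Comp Γ (fun e v => f e v - g e v) :=
  .op₂ (fun _ a b => a - b) (fun d => .sub (.read 4 (.const d)) (.read 4 (.const (d + 1))))
    (fun _ _ _ _ => rfl) hf hg

theorem Comp.read (a : ℕ) (ha : a ≠ 4) (hf : Comp Γ f) : Comp Γ (fun e v => e a (f e v)) :=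
  .op₂ (fun e i _ => e a i) (fun d => .read a (.read 4 (.const d)))
    (fun d e σ h => by simp only [RamExpr.eval]; rw [h.1 a ha]) hf hf

theorem Comp.ite (hf : Comp Γ f) (hg : Comp Γ g) (hh : Comp Γ h) :
    Comp Γ (fun e v => if f e v ≠ 0 then g e v else h e v) := by
  intro d rep hok
  obtain ⟨p, C, hp⟩ := hf d rep hok
  obtain ⟨q, C', hq⟩ := hg d rep hok
  obtain ⟨q', C'', hq'⟩ := hh d rep hok
  refine ⟨.seq p (.ite (.read 4 (.const d)) q q'), C + (3 + (C' + C'')), fun e v σ hi he hv => ?_⟩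
  obtain ⟨σ₁, t₁, a₁, a₂, a₃, a₄, a₅⟩ := hp e v σ hi he hv
  obtain ⟨σ₂, t₂, b₁, b₂, b₃, b₄, b₅⟩ := hq e v σ₁ hi a₃ (Γ.stable hok hv a₄)
  obtain ⟨σ₃, t₃, c₁, c₂, c₃, c₄, c₅⟩ := hq' e v σ₁ hi a₃ (Γ.stable hok hv a₄)
  by_cases h0 : f e v = 0
  · refine ⟨_, _, .seq a₁ (.ite_false (by simp [RamExpr.eval, a₅, h0]) c₁), ?_, c₃,
      fun i hi => by rw [c₄ i hi, a₄ i hi], by simp [h0, c₅]⟩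
    refine poly_add a₂ (poly_add (poly_const 3 _) (le_trans ?_ (poly_add b₂ c₂)))
    omega
  · refine ⟨_, _, .seq a₁ (.ite_true (by simp [RamExpr.eval, a₅, h0]) b₁), ?_, b₃,
      fun i hi => by rw [b₄ i hi, a₄ i hi], by simp [h0, b₅]⟩
    refine poly_add a₂ (poly_add (poly_const 3 _) (le_trans ?_ (poly_add b₂ c₂)))
    omega

/-- The value of an accumulator after `m` rounds of `s`, starting with `a`. -/
def iter {A : Type} (a : A) (s : A → ℕ → A) : ℕ → A
  | 0 => a
  | m + 1 => s (iter a s m) m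

/-- Iteration, with as many rounds as the loop bound says. -/
theorem Comp.iter {s : RamStore → V → ℕ → ℕ → ℕ} (hf : Comp Γ f)
    (hs : Comp Γ.acc.loop (fun e x => s e x.1.1 x.1.2 x.2)) :
    Comp Γ (fun e v => iter (f e v) (s e v) (e 4 0)) := by
  intro d rep hok
  -- The accumulator is kept in cell `d`, the loop variable in cell `d + 1`, and the new value of the
  -- accumulator is computed in cell `d + 2`.
  obtain ⟨p, C, hp⟩ := hf d rep hok
  obtain ⟨q, C', hq⟩ := hs (d + 2) _
    ⟨d + 1, _, d + 1, ⟨d, rep, d, hok, le_rfl, by omega, rfl⟩, le_rfl, by omega, rfl⟩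
  refine ⟨.seq p (.seq (.write 4 (.const (d + 1)) (.const 0))
    (.loop (.sub (.read 4 (.const 0)) (.read 4 (.const (d + 1))))
      (.seq q (.seq (.write 4 (.const d) (.read 4 (.const (d + 2))))
        (.write 4 (.const (d + 1)) (.add (.read 4 (.const (d + 1))) (.const 1))))))),
    C + (3 + ((C' + 16 + 1) + 6)), fun e v σ hi he hv => ?_⟩
  obtain ⟨σ₁, t₁, a₁, a₂, a₃, a₄, a₅⟩ := hp e v σ hi he hv
  have hd := Γ.pos hok
  obtain ⟨σ₂, t₂, b₁, b₂, b₃⟩ := runs_loop (B := e 4 0) (l := d + 1)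
    (K := C' * (e 4 0 + 1) ^ C' + 10)
    (body := .seq q (.seq (.write 4 (.const d) (.read 4 (.const (d + 2))))
        (.write 4 (.const (d + 1)) (.add (.read 4 (.const (d + 1))) (.const 1)))))
    (Inv := fun i τ => Presents e τ ∧ (∀ i < d, τ 4 i = σ 4 i) ∧
      τ 4 d = FallRam.iter (f e v) (s e v) i)
    (fun i hiB τ ⟨k₁, k₂, k₃⟩ hl => by
      obtain ⟨τ', u, c₁, c₂, c₃, c₄, c₅⟩ := hq e ((v, τ 4 d), i) τ ⟨⟨hi, trivial⟩, hiB⟩ k₁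
        ⟨⟨Γ.stable hok hv k₂, rfl⟩, hl⟩
      refine ⟨_, _, .seq c₁ (.seq (.write _ _ _ _) (.write _ _ _ _)), ?_,
        ⟨(c₃.set hd _).set (Nat.succ_pos d) _, ?_, ?_⟩, ?_⟩
      · simp only [RamExpr.cost]; omega
      · intro j hj
        simp only [RamExpr.eval, Function.update_self]
        rw [Function.update_of_ne (by omega), Function.update_of_ne (by omega), c₄ j (by omega),
          k₂ j hj]
      · simp only [RamExpr.eval, Function.update_self]
        rw [Function.update_of_ne (by omega), Function.update_self, c₅, k₃]
        rfl
      · simp only [RamExpr.eval, Function.update_self]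
        rw [Function.update_of_ne (by omega), c₄ (d + 1) (by omega), hl])
    (fun i τ hτ => hτ.1.2)
    (σ := Function.update σ₁ 4 (Function.update (σ₁ 4) (d + 1) 0))
    ⟨a₃.set (by omega) _, fun j hj => by
      rw [Function.update_self, Function.update_of_ne (by omega), a₄ j hj], by
      rw [Function.update_self, Function.update_of_ne (by omega), a₅]; rfl⟩
    (by rw [Function.update_self, Function.update_self])
  refine ⟨_, _, .seq a₁ (.seq (.write _ _ _ _) b₁), ?_, b₃⟩
  refine poly_add a₂ (poly_add (poly_const 3 _) (b₂.trans ?_))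
  refine poly_add (poly_mul ?_) (poly_const 6 _)
  rw [add_assoc]
  exact poly_add le_rfl (poly_const 16 _)

end Closure

/-! ### Programs that change the table -/

/-- `g` gives the new content of array `5`, which holds the table, and is computable in time polynomial in the loop
bound. -/
def Act {V : Type} (Γ : Ctx V) (g : RamStore → V → (ℕ → ℕ)) : Prop :=
  ∀ d rep, Γ.ok d rep → ∃ (p : RamProg) (C : ℕ), ∀ e v σ, Γ.inv e v → Presents e σ →
    rep v (σ 4) → ∃ σ' t, p.Runs σ σ' t ∧ t ≤ C * (e 4 0 + 1) ^ C ∧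
      Presents (Function.update e 5 (g e v)) σ' ∧ ∀ i < d, σ' 4 i = σ 4 i

section Act

variable {V : Type} {Γ : Ctx V}

/-- A conditional assignment of `1` to a cell of the table. -/
theorem Act.mark {f a : RamStore → V → ℕ} (hf : Comp Γ f) (ha : Comp Γ a) :
    Act Γ (fun e v => if f e v ≠ 0 then Function.update (e 5) (a e v) 1 else e 5) := by
  intro d rep hok
  obtain ⟨p, C, hp⟩ := hf d rep hok
  obtain ⟨q, C', hq⟩ := ha d rep hok
  refine ⟨.seq p (.ite (.read 4 (.const d)) (.seq q (.write 5 (.read 4 (.const d)) (.const 1)))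
    .skip), C + (3 + (C' + 4)), fun e v σ hi he hv => ?_⟩
  obtain ⟨σ₁, t₁, a₁, a₂, a₃, a₄, a₅⟩ := hp e v σ hi he hv
  obtain ⟨σ₂, t₂, b₁, b₂, b₃, b₄, b₅⟩ := hq e v σ₁ hi a₃ (Γ.stable hok hv a₄)
  by_cases h0 : f e v = 0
  · refine ⟨_, _, .seq a₁ (.ite_false (by simp [RamExpr.eval, a₅, h0]) (.skip _)), ?_, ?_, a₄⟩
    · refine poly_add a₂ (poly_add (poly_const 3 _) (le_trans ?_ (poly_add b₂ (poly_const 4 _))))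
      omega
    · simpa [h0] using a₃
  · refine ⟨_, _, .seq a₁ (.ite_true (by simp [RamExpr.eval, a₅, h0])
      (.seq b₁ (.write _ _ _ _))), ?_, ⟨fun c hc => ?_, ?_⟩, fun i hi => ?_⟩
    · refine poly_add a₂ (poly_add (poly_const 3 _) (poly_add b₂ (le_trans ?_ (poly_const 4 _))))
      simp [RamExpr.cost]
    · by_cases hc5 : c = 5
      · subst hc5
        simp only [Function.update_self, RamExpr.eval, if_pos h0, ne_eq, b₅]
        rw [b₃.1 5 (by omega)]
      · rw [Function.update_of_ne hc5, Function.update_of_ne hc5, b₃.1 c hc]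
    · simpa using b₃.2
    · rw [Function.update_of_ne (by omega), b₄ i hi, a₄ i hi]

/-- A loop that updates the table in each round. -/
theorem Act.loop {g : RamStore → V → ℕ → (ℕ → ℕ)} (hg : Act Γ.loop (fun e x => g e x.1 x.2)) :
    Act Γ (fun e v => iter (e 5) (fun F i => g (Function.update e 5 F) v i) (e 4 0)) := by
  intro d rep hok
  have hd := Γ.pos hok
  -- The loop variable is kept in cell `d`.
  obtain ⟨q, C, hq⟩ := hg (d + 1) _ ⟨d, rep, d, hok, le_rfl, by omega, rfl⟩
  refine ⟨.seq (.write 4 (.const d) (.const 0))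
    (.loop (.sub (.read 4 (.const 0)) (.read 4 (.const d)))
      (.seq q (.write 4 (.const d) (.add (.read 4 (.const d)) (.const 1))))),
    3 + ((C + 12 + 1) + 6), fun e v σ hi he hv => ?_⟩
  obtain ⟨σ₂, t₂, b₁, b₂, b₃⟩ := runs_loop (B := e 4 0) (l := d)
    (K := C * (e 4 0 + 1) ^ C + 6)
    (body := .seq q (.write 4 (.const d) (.add (.read 4 (.const d)) (.const 1))))
    (Inv := fun i τ => Presents (Function.update e 5
        (FallRam.iter (e 5) (fun F i => g (Function.update e 5 F) v i) i)) τ ∧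
      ∀ i < d, τ 4 i = σ 4 i)
    (fun i hiB τ ⟨k₁, k₂⟩ hl => by
      obtain ⟨τ', u, c₁, c₂, c₃, c₄⟩ := hq _ (v, i) τ
        ⟨Γ.inv_table _ hi, by simpa using hiB⟩ k₁ ⟨Γ.stable hok hv k₂, hl⟩
      refine ⟨_, _, .seq c₁ (.write _ _ _ _), ?_, ⟨?_, ?_⟩, ?_⟩
      · have : (4 : ℕ) ≠ 5 := by omega
        simp only [Function.update_of_ne this] at c₂
        simp only [RamExpr.cost]; omega
      · refine Presents.set ?_ hd _
        rw [Function.update_idem] at c₃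
        exact c₃
      · intro j hj
        simp only [RamExpr.eval, Function.update_self]
        rw [Function.update_of_ne (by omega), c₄ j (by omega), k₂ j hj]
      · simp only [RamExpr.eval, Function.update_self]
        rw [c₄ d (by omega), hl])
    (fun i τ hτ => by rw [hτ.1.2, Function.update_of_ne (by omega)])
    (σ := Function.update σ 4 (Function.update (σ 4) d 0))
    ⟨by simpa [FallRam.iter] using he.set hd _, fun j hj => by
      rw [Function.update_self, Function.update_of_ne (by omega)]⟩
    (by rw [Function.update_self, Function.update_self])
  refine ⟨_, _, .seq (.write _ _ _ _) b₁, ?_, b₃⟩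
  refine poly_add (poly_const 3 _) (b₂.trans ?_)
  refine poly_add (poly_mul ?_) (poly_const 6 _)
  rw [add_assoc]
  exact poly_add le_rfl (poly_const 12 _)

end Act

/-- The memory `e` with `x` written to cell `i` of array `a`. -/
def put (e : RamStore) (a i x : ℕ) : RamStore := Function.update e a (Function.update (e a) i x)

/-- Computing a number from the data and storing it in a fixed cell. -/
theorem Comp.store {I : RamStore → Prop} {hI} {f : RamStore → ℕ}
    (hf : Comp (Ctx.base I hI) (fun e _ => f e)) (a i : ℕ) (ha : a = 4 → i = 0) :
    ∃ (p : RamProg) (C : ℕ), ∀ e σ, I e → Presents e σ →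
      ∃ σ' t, p.Runs σ σ' t ∧ t ≤ C * (e 4 0 + 1) ^ C ∧ Presents (put e a i (f e)) σ' := by
  obtain ⟨p, C, hp⟩ := hf 1 _ ⟨by omega, rfl⟩
  refine ⟨.seq p (.write a (.const i) (.read 4 (.const 1))), C + 4, fun e σ hi he => ?_⟩
  obtain ⟨σ₁, t₁, a₁, a₂, a₃, a₄, a₅⟩ := hp e () σ hi he trivial
  refine ⟨_, _, .seq a₁ (.write _ _ _ _), poly_add a₂ (poly_const 4 _), fun c hc => ?_, ?_⟩
  · simp only [RamExpr.eval, a₅, put]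
    by_cases h : c = a
    · subst h
      rw [Function.update_self, Function.update_self, a₃.1 c hc]
    · rw [Function.update_of_ne h, Function.update_of_ne h, a₃.1 c hc]
  · simp only [RamExpr.eval, a₅, put]
    by_cases h : 4 = a
    · subst h
      simp [ha rfl]
    · rw [Function.update_of_ne h, Function.update_of_ne h, a₃.2]

end FallRam

/-! ### Digits and multisets of exponents -/

namespace FallRam

open Classical in
/-- The truth value of `p` as a number. -/
noncomputable def ind (p : Prop) : ℕ := if p then 1 else 0

theorem ind_ne_zero {p : Prop} : ind p ≠ 0 ↔ p := by
  unfold ind; split <;> simp_all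

theorem ind_lt_two (p : Prop) : ind p < 2 := by
  unfold ind; split <;> simp

theorem ind_of {p : Prop} (h : p) : ind p = 1 := if_pos h

theorem ind_of_not {p : Prop} (h : ¬ p) : ind p = 0 := if_neg h

theorem ind_eq_one {p : Prop} : ind p = 1 ↔ p := by
  unfold ind; split <;> simp_all

theorem sum_digits_lt {b : ℕ} {c : ℕ → ℕ} (hc : ∀ i, c i < b) (m : ℕ) :
    ∑ i ∈ Finset.range m, c i * b ^ i < b ^ m := by
  induction m with
  | zero => simp
  | succ m ih =>
    rw [Finset.sum_range_succ, pow_succ]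
    have := Nat.mul_le_mul_right (b ^ m) (Nat.succ_le_of_lt (hc m))
    rw [Nat.succ_mul] at this
    rw [mul_comm (b ^ m) b]
    omega

theorem digit_sum {b : ℕ} {c : ℕ → ℕ} (hc : ∀ i, c i < b) (m j : ℕ) :
    (∑ i ∈ Finset.range m, c i * b ^ i) / b ^ j % b = if j < m then c j else 0 := by
  have hb : 0 < b := (Nat.zero_le _).trans_lt (hc 0)
  induction m generalizing c j with
  | zero => simp
  | succ m ih =>
    have hs : ∑ i ∈ Finset.range (m + 1), c i * b ^ i
        = c 0 + b * ∑ i ∈ Finset.range m, c (i + 1) * b ^ i := by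
      rw [Finset.sum_range_succ', Finset.mul_sum, add_comm]
      simp only [pow_zero, mul_one]
      congr 1
      exact Finset.sum_congr rfl fun i _ => by ring
    rw [hs]
    cases j with
    | zero => simp [Nat.mod_eq_of_lt (hc 0)]
    | succ j =>
      rw [pow_succ', ← Nat.div_div_eq_div_mul, Nat.add_mul_div_left _ _ hb,
        Nat.div_eq_of_lt (hc 0), zero_add, ih (fun i => hc (i + 1))]
      simp

/-- The number whose binary digits below `m` are given by `P`. -/
noncomputable def bitsum (m : ℕ) (P : ℕ → Prop) : ℕ := ∑ i ∈ Finset.range m, ind (P i) * 2 ^ i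

theorem bitsum_lt (m : ℕ) (P : ℕ → Prop) : bitsum m P < 2 ^ m :=
  sum_digits_lt (fun _ => ind_lt_two _) m

/-- Bit `i` of `x` is set. -/
def Bit (x i : ℕ) : Prop := x / 2 ^ i % 2 = 1

theorem bit_bitsum {m : ℕ} {P : ℕ → Prop} {i : ℕ} : Bit (bitsum m P) i ↔ i < m ∧ P i := by
  rw [Bit, bitsum, digit_sum (fun _ => ind_lt_two _)]
  split_ifs with h
  · simp [ind_eq_one, h]
  · simp [h]

theorem Bit.two_pow_le {x i : ℕ} (h : Bit x i) : 2 ^ i ≤ x := by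
  by_contra hc
  rw [Bit, Nat.div_eq_of_lt (by omega)] at h
  simp at h

theorem bitsum_congr {m : ℕ} {P Q : ℕ → Prop} (h : ∀ i, P i ↔ Q i) : bitsum m P = bitsum m Q := by
  rw [show P = Q from funext fun i => propext (h i)]

/-- The base `b` code of the multiset of the values of `g`. -/
def code {k : ℕ} (b : ℕ) (g : Fin k → ℕ) : ℕ := ∑ i, b ^ g i

/-- The digit of `M` at place `i` in base `b`. -/
def digit (b M i : ℕ) : ℕ := M / b ^ i % b

theorem sum_eq_sum_card {k L : ℕ} {g : Fin k → ℕ} (hg : ∀ i, g i < L) (h : ℕ → ℕ) :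
    ∑ i, h (g i) = ∑ x ∈ Finset.range L, (Finset.univ.filter fun i => g i = x).card * h x := by
  rw [← Finset.sum_fiberwise_of_maps_to (s := Finset.univ) (t := Finset.range L) (g := g)
    (fun i _ => Finset.mem_range.2 (hg i))]
  refine Finset.sum_congr rfl fun x _ => ?_
  rw [Finset.sum_congr rfl (g := fun _ => h x) (by simp +contextual), Finset.sum_const, smul_eq_mul]

theorem card_fiber_lt {k b : ℕ} (hk : k < b) (g : Fin k → ℕ) (x : ℕ) :
    (Finset.univ.filter fun i => g i = x).card < b :=
  ((Finset.card_filter_le _ _).trans (by simp)).trans_lt hk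

theorem code_lt {k b L : ℕ} (hk : k < b) {g : Fin k → ℕ} (hg : ∀ i, g i < L) :
    code b g < b ^ L := by
  rw [code, sum_eq_sum_card hg]
  exact sum_digits_lt (card_fiber_lt hk g) L

theorem digit_code {k b : ℕ} (hk : k < b) (g : Fin k → ℕ) (x : ℕ) :
    digit b (code b g) x = (Finset.univ.filter fun i => g i = x).card := by
  obtain ⟨L, hL⟩ : ∃ L, ∀ i, g i < L :=
    ⟨Finset.univ.sup g + 1, fun i => Nat.lt_succ_of_le (Finset.le_sup (Finset.mem_univ i))⟩
  rw [digit, code, sum_eq_sum_card hL, digit_sum (card_fiber_lt hk g)]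
  split_ifs with h
  · rfl
  · rw [eq_comm, Finset.card_eq_zero, Finset.filter_eq_empty_iff]
    intro i _ hi
    exact h (hi ▸ hL i)

/-- The code determines the multiset of exponents, that is, the sequence of exponents up to
a permutation. -/
theorem exists_perm_of_code_eq {k b : ℕ} (hk : k < b) {f g : Fin k → ℕ}
    (h : code b f = code b g) : ∃ π : Equiv.Perm (Fin k), ∀ i, f (π i) = g i := by
  have hc : ∀ x, Fintype.card {i // g i = x} = Fintype.card {i // f i = x} := fun x => by
    rw [Fintype.card_subtype, Fintype.card_subtype, ← digit_code hk, ← digit_code hk, h]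
  refine ⟨Equiv.ofFiberEquiv fun x => Fintype.equivOfCardEq (hc x), fun i => ?_⟩
  exact Equiv.ofFiberEquiv_map _ i

/-- A sequence with prescribed numbers of occurrences. -/
theorem exists_of_sum_eq {L k : ℕ} {c : ℕ → ℕ} (hc : ∑ x ∈ Finset.range L, c x = k) :
    ∃ g : Fin k → ℕ, (∀ i, g i < L ∧ c (g i) ≠ 0) ∧
      ∀ h : ℕ → ℕ, ∑ i, h (g i) = ∑ x ∈ Finset.range L, c x * h x := by
  set m : Multiset ℕ := ∑ x ∈ Finset.range L, Multiset.replicate (c x) x with hm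
  have hcard : m.toList.length = k := by
    rw [Multiset.length_toList, hm, Multiset.card_sum, ← hc]
    simp
  subst hcard
  refine ⟨fun i => m.toList.get i, fun i => ?_, fun h => ?_⟩
  · have : m.toList.get i ∈ m := Multiset.mem_toList.1 (List.get_mem _ _)
    simp only [hm, Multiset.mem_sum] at this
    obtain ⟨x, hx, hi⟩ := this
    rw [Multiset.mem_replicate] at hi
    simp only [List.get_eq_getElem] at hi ⊢
    rw [hi.2]
    exact ⟨Finset.mem_range.1 hx, hi.1⟩
  · have h₁ : ∑ i, h (m.toList.get i) = (m.toList.map h).sum := by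
      conv_rhs => rw [← List.ofFn_get m.toList, List.map_ofFn, List.sum_ofFn]
      rfl
    rw [h₁, ← Multiset.sum_coe, ← Multiset.map_coe, Multiset.coe_toList, hm]
    rw [← Multiset.coe_mapAddMonoidHom, map_sum, Multiset.sum_sum]
    simp

end FallRam

/-! ### Parts, classes, and types of color classes -/

namespace FallRam

/-- The data of an instance in terms of natural numbers: a graph on the vertices below `n`, the
number `k` of colors, a tree on the nodes below `N`, and the leaf of each vertex.

A *part* is a natural number `p` that stands for a set of vertices: the set `V_p` if `p` is a node,
the set `{v}` if `p = N + v`, and the empty set if `p ≥ N + n`. -/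
structure Inst where
  n : ℕ
  N : ℕ
  k : ℕ
  root : ℕ
  adj : ℕ → ℕ → Prop
  par : ℕ → ℕ
  leaf : ℕ → ℕ

namespace Inst

variable (X : Inst)

/-- The vertex `v` belongs to the part `p`. -/
def Mem (p v : ℕ) : Prop :=
  (p < X.N ∧ ∃ i < X.N, X.par^[i] (X.leaf v) = p) ∨ (¬ p < X.N ∧ p = X.N + v)

/-- `u` and `v` have the same neighbors outside the part `p`. -/
def Eqv (p u v : ℕ) : Prop := ∀ x < X.n, ¬ X.Mem p x → (X.adj u x ↔ X.adj v x)

/-- No vertex of the part `p` below `u` is equivalent to `v`. -/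
def NoneBelow (p u v : ℕ) : Prop := ∀ x < u, X.Mem p x → ¬ X.Eqv p x v

/-- `u` is the least element of its class in the part `p`. -/
def IsRep (p u : ℕ) : Prop := X.Mem p u ∧ X.NoneBelow p u u

/-- The number of the class of `v` in the part `p`: the number of classes with a smaller least
element. -/
noncomputable def cls (p v : ℕ) : ℕ :=
  ∑ u ∈ Finset.range X.n, ind (X.IsRep p u ∧ X.NoneBelow p (u + 1) v)

/-- The number of classes of the part `p`. -/
noncomputable def numCls (p : ℕ) : ℕ := ∑ u ∈ Finset.range X.n, ind (X.IsRep p u)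

/-- The largest number of classes of a node. -/
noncomputable def width : ℕ := (Finset.range X.N).sup X.numCls

/-- The type of a set `S` of vertices in the part `p`, as a binary number of length twice the
width: bit `a` tells whether `S` meets class `a`, and bit `width + a` whether class `a` contains a
vertex that neither is in `S` nor has a neighbor in the intersection of `S` with the part. -/
noncomputable def typ (p : ℕ) (S : ℕ → Prop) : ℕ :=
  bitsum (2 * X.width) fun a => ∃ v < X.n, X.Mem p v ∧ ((a = X.cls p v ∧ S v) ∨
    (a = X.width + X.cls p v ∧ ¬ S v ∧ ∀ u < X.n, X.Mem p u → S u → ¬ X.adj u v))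

/-- Entry `j` of a triple of types with code `θ`. -/
noncomputable def prj (j θ : ℕ) : ℕ := θ / 2 ^ (2 * X.width * j) % 2 ^ (2 * X.width)

/-- According to the triple `θ` of types, a set meets the class of `u` in part `P j`. -/
def Sel (P : ℕ → ℕ) (j θ u : ℕ) : Prop := Bit (X.prj j θ) (X.cls (P j) u)

/-- According to the triple `θ` of types, the class of `u` in part `P j` contains a vertex that is
not dominated within the part. -/
def Und (P : ℕ → ℕ) (j θ u : ℕ) : Prop := Bit (X.prj j θ) (X.width + X.cls (P j) u)

/-- A set with the triple `θ` of types has no neighbor of `v` in the parts `P i`, `i ≠ j`. -/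
def Away (P : ℕ → ℕ) (j θ v : ℕ) : Prop :=
  ∀ i < 3, i ≠ j → ∀ u < X.n, X.Mem (P i) u → X.Sel P i θ u → ¬ X.adj u v

/-- A set with the triple `θ` of types has no edges between different parts. -/
def Allowed (P : ℕ → ℕ) (θ : ℕ) : Prop :=
  ∀ j < 3, ∀ v < X.n, X.Mem (P j) v → X.Sel P j θ v → X.Away P j θ v

/-- The type in `t`, the disjoint union of three parts `P j`, of a set with the triple `θ` of
types in these parts. -/
noncomputable def res (t : ℕ) (P : ℕ → ℕ) (θ : ℕ) : ℕ :=
  bitsum (2 * X.width) fun a => ∃ v < X.n, ∃ j < 3, X.Mem (P j) v ∧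
    ((a = X.cls t v ∧ X.Sel P j θ v) ∨
      (a = X.width + X.cls t v ∧ X.Und P j θ v ∧ X.Away P j θ v))

/-- The part `t` is the disjoint union of the parts `P 0`, `P 1` and `P 2`. -/
def Splits (t : ℕ) (P : ℕ → ℕ) : Prop :=
  ∀ v < X.n, ind (X.Mem t v) = ∑ j ∈ Finset.range 3, ind (X.Mem (P j) v)

/-- `φ` colors the part `t` properly with `k` colors, and `s` is the code of the multiset of the
types of its color classes. -/
def Colors (t s : ℕ) (φ : ℕ → Fin X.k) : Prop :=
  (∀ u < X.n, ∀ v < X.n, X.Mem t u → X.Mem t v → φ u = φ v → ¬ X.adj u v) ∧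
    s = code (X.n + 1) fun i => X.typ t fun v => φ v = i

/-- `s` is the code of the multiset of types of a proper coloring of the part `t`. -/
def Good (t s : ℕ) : Prop := ∃ φ, X.Colors t s φ

variable {X}

theorem Eqv.symm {p u v : ℕ} (h : X.Eqv p u v) : X.Eqv p v u := fun x hx hm => (h x hx hm).symm

theorem Eqv.trans {p u v w : ℕ} (h : X.Eqv p u v) (h' : X.Eqv p v w) : X.Eqv p u w :=
  fun x hx hm => (h x hx hm).trans (h' x hx hm)

theorem Eqv.refl (p u : ℕ) : X.Eqv p u u := fun _ _ _ => Iff.rfl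

/-- Every class has a least element. -/
theorem exists_rep {p v : ℕ} (hv : v < X.n) (hm : X.Mem p v) :
    ∃ r < X.n, X.IsRep p r ∧ X.Eqv p r v := by
  classical
  have hex : ∃ r, X.Mem p r ∧ X.Eqv p r v := ⟨v, hm, Eqv.refl p v⟩
  have hs := Nat.find_spec hex
  refine ⟨Nat.find hex, (Nat.find_min' hex ⟨hm, Eqv.refl p v⟩).trans_lt hv, ⟨hs.1, ?_⟩, hs.2⟩
  intro x hx hxm hxe
  exact Nat.find_min hex hx ⟨hxm, hxe.trans hs.2⟩

theorem Eqv.cls_eq {p u v : ℕ} (h : X.Eqv p u v) : X.cls p u = X.cls p v := by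
  have : ∀ w, X.NoneBelow p w u ↔ X.NoneBelow p w v := fun w =>
    ⟨fun a x hx hm he => a x hx hm (he.trans h.symm), fun a x hx hm he => a x hx hm (he.trans h)⟩
  simp only [cls, this]

theorem cls_lt_of_rep {p r v : ℕ} (hr : r < X.n) (h : X.IsRep p r) (he : X.Eqv p r v) :
    X.cls p v < X.numCls p := by
  refine Finset.sum_lt_sum (fun u _ => ?_) ⟨r, Finset.mem_range.2 hr, ?_⟩
  · by_cases hu : X.IsRep p u
    · rw [ind_of hu]; exact Nat.lt_succ_iff.1 (ind_lt_two _)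
    · rw [ind_of_not fun h => hu h.1]; exact Nat.zero_le _
  · rw [ind_of h, ind_of_not fun h' => h'.2 r (by omega) h.1 he]
    exact one_pos

theorem cls_lt_numCls {p v : ℕ} (hv : v < X.n) (hm : X.Mem p v) : X.cls p v < X.numCls p := by
  obtain ⟨r, hr, h, he⟩ := exists_rep hv hm
  exact cls_lt_of_rep hr h he

theorem cls_lt_cls {p r s : ℕ} (hr : r < X.n) (h : X.IsRep p r) (h' : X.IsRep p s) (hrs : r < s) :
    X.cls p r < X.cls p s := by
  refine Finset.sum_lt_sum (fun u _ => ?_) ⟨r, Finset.mem_range.2 hr, ?_⟩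
  · by_cases hu : X.IsRep p u ∧ X.NoneBelow p (u + 1) r
    · have hur : u < r := by
        by_contra hc
        exact hu.2 r (by omega) h.1 (Eqv.refl p r)
      rw [ind_of hu, ind_of ⟨hu.1, fun x hx => h'.2 x (by omega)⟩]
    · rw [ind_of_not hu]; exact Nat.zero_le _
  · rw [ind_of_not fun a => a.2 r (by omega) h.1 (Eqv.refl p r),
      ind_of ⟨h, fun x hx => h'.2 x (by omega)⟩]
    exact one_pos

theorem eqv_of_cls_eq {p u v : ℕ} (hu : u < X.n) (hv : v < X.n) (hmu : X.Mem p u)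
    (hmv : X.Mem p v) (h : X.cls p u = X.cls p v) : X.Eqv p u v := by
  obtain ⟨r, hr, hr', hru⟩ := exists_rep hu hmu
  obtain ⟨s, hs, hs', hsv⟩ := exists_rep hv hmv
  rw [← hru.cls_eq, ← hsv.cls_eq] at h
  rcases lt_trichotomy r s with hrs | hrs | hrs
  · have := cls_lt_cls hr hr' hs' hrs; omega
  · exact hru.symm.trans (hrs ▸ hsv)
  · have := cls_lt_cls hs hs' hr' hrs; omega

theorem cls_le (p v : ℕ) : X.cls p v ≤ X.n := by
  refine (Finset.sum_le_card_nsmul _ _ 1 fun u _ => Nat.lt_succ_iff.1 (ind_lt_two _)).trans ?_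
  simp

theorem numCls_le (p : ℕ) : X.numCls p ≤ X.n := by
  refine (Finset.sum_le_card_nsmul _ _ 1 fun u _ => Nat.lt_succ_iff.1 (ind_lt_two _)).trans ?_
  simp

theorem width_le : X.width ≤ X.n := Finset.sup_le fun p _ => numCls_le p

/-- A part that is not a node has at most one element, hence no class with a positive number. -/
theorem cls_lt_width (hw : 0 < X.width) {p v : ℕ} (hv : v < X.n) (hm : X.Mem p v) :
    X.cls p v < X.width := by
  by_cases hp : p < X.N
  · exact (cls_lt_numCls hv hm).trans_le (Finset.le_sup (Finset.mem_range.2 hp))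
  · refine lt_of_eq_of_lt (Finset.sum_eq_zero fun u hu => ind_of_not ?_) hw
    rintro ⟨h, h'⟩
    have h₁ : p = X.N + u := by
      rcases h.1 with h | h
      · exact absurd h.1 hp
      · exact h.2
    have h₂ : p = X.N + v := by
      rcases hm with h | h
      · exact absurd h.1 hp
      · exact h.2
    obtain rfl : u = v := by omega
    exact h' u (by omega) hm (Eqv.refl _ _)

theorem typ_lt (p : ℕ) (S : ℕ → Prop) : X.typ p S < 2 ^ (2 * X.width) := bitsum_lt _ _

theorem res_lt (t : ℕ) (P : ℕ → ℕ) (θ : ℕ) : X.res t P θ < 2 ^ (2 * X.width) := bitsum_lt _ _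

theorem prj_lt (j θ : ℕ) : X.prj j θ < 2 ^ (2 * X.width) := Nat.mod_lt _ (by positivity)

/-- Every triple of types has a code. -/
theorem exists_prj (τ : ℕ → ℕ) (hτ : ∀ j, τ j < 2 ^ (2 * X.width)) :
    ∃ θ < 2 ^ (6 * X.width), ∀ j < 3, X.prj j θ = τ j := by
  refine ⟨∑ i ∈ Finset.range 3, τ i * (2 ^ (2 * X.width)) ^ i, ?_, fun j hj => ?_⟩
  · refine (sum_digits_lt hτ 3).trans_eq ?_
    rw [← pow_mul]; congr 1; ring
  · rw [prj, pow_mul 2 (2 * X.width) j, digit_sum hτ, if_pos hj]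

theorem typ_congr {p : ℕ} {S S' : ℕ → Prop} (h : ∀ v < X.n, X.Mem p v → (S v ↔ S' v)) :
    X.typ p S = X.typ p S' := by
  refine bitsum_congr fun a => exists_congr fun v => and_congr_right fun hv =>
    and_congr_right fun mv => ?_
  rw [h v hv mv]
  refine or_congr Iff.rfl (and_congr_right fun _ => and_congr_right fun _ => ?_)
  refine forall_congr' fun u => forall_congr' fun hu => forall_congr' fun mu => ?_
  rw [h u hu mu]

section Types

variable (hw : 0 < X.width) {p : ℕ} {S : ℕ → Prop}
include hw

theorem bit_typ_cls {v : ℕ} (hv : v < X.n) (hm : X.Mem p v) :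
    Bit (X.typ p S) (X.cls p v) ↔ ∃ u < X.n, X.Mem p u ∧ X.Eqv p u v ∧ S u := by
  have hc := cls_lt_width hw hv hm
  rw [typ, bit_bitsum]
  constructor
  · rintro ⟨-, u, hu, mu, h | h⟩
    · exact ⟨u, hu, mu, eqv_of_cls_eq hu hv mu hm h.1.symm, h.2⟩
    · omega
  · rintro ⟨u, hu, mu, he, h⟩
    exact ⟨by omega, u, hu, mu, Or.inl ⟨he.symm.cls_eq, h⟩⟩

theorem bit_typ_width_add {v : ℕ} (hv : v < X.n) (hm : X.Mem p v) :
    Bit (X.typ p S) (X.width + X.cls p v) ↔ ∃ u < X.n, X.Mem p u ∧ X.Eqv p u v ∧ ¬ S u ∧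
      ∀ x < X.n, X.Mem p x → S x → ¬ X.adj x u := by
  have hc := cls_lt_width hw hv hm
  rw [typ, bit_bitsum]
  constructor
  · rintro ⟨-, u, hu, mu, h | h⟩
    · have := cls_lt_width hw hu mu
      omega
    · exact ⟨u, hu, mu, eqv_of_cls_eq hu hv mu hm (by omega), h.2⟩
  · rintro ⟨u, hu, mu, he, h⟩
    exact ⟨by omega, u, hu, mu, Or.inr ⟨by rw [he.cls_eq], h⟩⟩

end Types

/-! ### Merging three parts -/

section Merge

variable {t : ℕ} {P : ℕ → ℕ}

theorem Splits.mem_iff (h : X.Splits t P) {v : ℕ} (hv : v < X.n) :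
    X.Mem t v ↔ ∃ j < 3, X.Mem (P j) v := by
  have := h v hv
  constructor
  · intro hm
    by_contra! hc
    rw [ind_of hm, Finset.sum_eq_zero fun j hj => ind_of_not (hc j (Finset.mem_range.1 hj))] at this
    omega
  · rintro ⟨j, hj, hm⟩
    by_contra hc
    rw [ind_of_not hc, eq_comm, Finset.sum_eq_zero_iff] at this
    exact ind_ne_zero.2 hm (this j (Finset.mem_range.2 hj))

theorem Splits.eq (h : X.Splits t P) {i j v : ℕ} (hi : i < 3) (hj : j < 3) (hv : v < X.n)
    (mi : X.Mem (P i) v) (mj : X.Mem (P j) v) : i = j := by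
  by_contra hij
  have h₁ := h v hv
  have h₂ : ∑ x ∈ {i, j}, ind (X.Mem (P x) v) ≤ ∑ x ∈ Finset.range 3, ind (X.Mem (P x) v) := by
    refine Finset.sum_le_sum_of_subset fun x hx => ?_
    simp only [Finset.mem_insert, Finset.mem_singleton] at hx
    rw [Finset.mem_range]; omega
  rw [Finset.sum_pair hij, ind_of mi, ind_of mj] at h₂
  have := ind_lt_two (X.Mem t v)
  omega

/-- Equivalence in a part implies equivalence in a larger part. -/
theorem Splits.eqv (h : X.Splits t P) {j u v : ℕ} (hj : j < 3) (he : X.Eqv (P j) u v) :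
    X.Eqv t u v := fun x hx hm => he x hx fun m => hm ((h.mem_iff hx).2 ⟨j, hj, m⟩)

variable (hw : 0 < X.width)
include hw

/-- The adjacency of a vertex `v` outside `P i` to a set depends only on the classes of `P i` that
the set meets. -/
theorem exists_sel_adj {i θ v : ℕ} {S : ℕ → Prop} (hθ : X.prj i θ = X.typ (P i) S)
    (hv : v < X.n) (hm : ¬ X.Mem (P i) v) :
    (∀ u < X.n, X.Mem (P i) u → X.Sel P i θ u → ¬ X.adj u v) ↔
      ∀ u < X.n, X.Mem (P i) u → S u → ¬ X.adj u v := by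
  constructor
  · intro h u hu mu su
    refine h u hu mu ?_
    rw [Sel, hθ, bit_typ_cls hw hu mu]
    exact ⟨u, hu, mu, Eqv.refl _ _, su⟩
  · intro h u hu mu su
    rw [Sel, hθ, bit_typ_cls hw hu mu] at su
    obtain ⟨x, hx, mx, he, sx⟩ := su
    rw [← he v hv hm]
    exact h x hx mx sx

variable (hadj : ∀ u v, X.adj u v → X.adj v u)
  (h : X.Splits t P) {θ : ℕ} {S : ℕ → Prop}
  (hθ : ∀ j < 3, X.prj j θ = X.typ (P j) S)
include h hθ

theorem away_iff {j v : ℕ} (hj : j < 3) (hv : v < X.n) (hm : X.Mem (P j) v) :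
    X.Away P j θ v ↔ ∀ i < 3, i ≠ j → ∀ u < X.n, X.Mem (P i) u → S u → ¬ X.adj u v := by
  refine forall_congr' fun i => forall_congr' fun hi => forall_congr' fun hij => ?_
  exact exists_sel_adj hw (hθ i hi) hv fun m => hij (h.eq hi hj hv m hm)

include hadj

/-- Whether a set has edges between different parts is determined by its types in the parts. -/
theorem allowed_iff : X.Allowed P θ ↔ ∀ j < 3, ∀ v < X.n, X.Mem (P j) v → S v →
    ∀ i < 3, i ≠ j → ∀ u < X.n, X.Mem (P i) u → S u → ¬ X.adj u v := by
  constructor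
  · intro ha j hj v hv mv sv
    rw [← away_iff hw h hθ hj hv mv]
    refine ha j hj v hv mv ?_
    rw [Sel, hθ j hj, bit_typ_cls hw hv mv]
    exact ⟨v, hv, mv, Eqv.refl _ _, sv⟩
  · intro ha j hj v hv mv sv
    rw [away_iff hw h hθ hj hv mv]
    intro i hi hij u hu mu su huv
    rw [Sel, hθ j hj, bit_typ_cls hw hv mv] at sv
    obtain ⟨x, hx, mx, he, sx⟩ := sv
    refine ha j hj x hx mx sx i hi hij u hu mu su (hadj _ _ ?_)
    rw [he u hu fun m => hij (h.eq hi hj hu mu m)]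
    exact hadj _ _ huv

/-- The type of a set in the union is determined by its types in the parts. -/
theorem typ_eq_res : X.typ t S = X.res t P θ := by
  refine bitsum_congr fun a => ?_
  constructor
  · rintro ⟨v, hv, mv, hva⟩
    obtain ⟨j, hj, mj⟩ := (h.mem_iff hv).1 mv
    refine ⟨v, hv, j, hj, mj, ?_⟩
    rcases hva with ⟨ha, sv⟩ | ⟨ha, sv, dv⟩
    · refine Or.inl ⟨ha, ?_⟩
      rw [Sel, hθ j hj, bit_typ_cls hw hv mj]
      exact ⟨v, hv, mj, Eqv.refl _ _, sv⟩
    · refine Or.inr ⟨ha, ?_, ?_⟩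
      · rw [Und, hθ j hj, bit_typ_width_add hw hv mj]
        exact ⟨v, hv, mj, Eqv.refl _ _, sv, fun x hx mx =>
          dv x hx ((h.mem_iff hx).2 ⟨j, hj, mx⟩)⟩
      · rw [away_iff hw h hθ hj hv mj]
        exact fun i hi _ u hu mu => dv u hu ((h.mem_iff hu).2 ⟨i, hi, mu⟩)
  · rintro ⟨v, hv, j, hj, mj, ⟨ha, sv⟩ | ⟨ha, uv, av⟩⟩
    · rw [Sel, hθ j hj, bit_typ_cls hw hv mj] at sv
      obtain ⟨x, hx, mx, he, sx⟩ := sv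
      refine ⟨x, hx, (h.mem_iff hx).2 ⟨j, hj, mx⟩, Or.inl ⟨?_, sx⟩⟩
      rw [ha, (h.eqv hj he).cls_eq]
    · rw [Und, hθ j hj, bit_typ_width_add hw hv mj] at uv
      obtain ⟨x, hx, mx, he, sx, dx⟩ := uv
      refine ⟨x, hx, (h.mem_iff hx).2 ⟨j, hj, mx⟩, Or.inr ⟨?_, sx, ?_⟩⟩
      · rw [ha, (h.eqv hj he).cls_eq]
      · intro u hu mu su
        obtain ⟨i, hi, mi⟩ := (h.mem_iff hu).1 mu
        by_cases hij : i = j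
        · subst hij
          exact dx u hu mi su
        · intro hux
          refine (away_iff hw h hθ hj hv mj).1 av i hi hij u hu mi su (hadj _ _ ?_)
          rw [← he u hu fun m => hij (h.eq hi hj hu mi m)]
          exact hadj _ _ hux

omit hθ

/-- The colorings of the parts, with their colors permuted according to `M`, combine to a coloring
of the union. -/
theorem good_of_merge (hk : 0 < X.k) (hkn : X.k ≤ X.n) {L M : ℕ}
    (hM : ∑ x ∈ Finset.range L, digit (X.n + 1) M x = X.k)
    (ha : ∀ x < L, digit (X.n + 1) M x ≠ 0 → X.Allowed P x)
    (hP : ∀ j < 3, X.Good (P j)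
      (∑ x ∈ Finset.range L, digit (X.n + 1) M x * (X.n + 1) ^ X.prj j x)) :
    X.Good t (∑ x ∈ Finset.range L, digit (X.n + 1) M x * (X.n + 1) ^ X.res t P x) := by
  classical
  obtain ⟨g, hg, hsum⟩ := exists_of_sum_eq hM
  -- The sequence `g` assigns a triple of types to each color. By permuting the colors of part `j`,
  -- color `i` of this part gets the type that `g i` prescribes.
  have hφ : ∀ j < 3, ∃ φ : ℕ → Fin X.k,
      (∀ u < X.n, ∀ v < X.n, X.Mem (P j) u → X.Mem (P j) v → φ u = φ v → ¬ X.adj u v) ∧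
      ∀ i, X.typ (P j) (fun v => φ v = i) = X.prj j (g i) := by
    intro j hj
    obtain ⟨φ, h₁, h₂⟩ := hP j hj
    rw [← hsum fun x => (X.n + 1) ^ X.prj j x] at h₂
    obtain ⟨π, hπ⟩ := exists_perm_of_code_eq (Nat.lt_succ_of_le hkn) h₂.symm
    refine ⟨fun v => π.symm (φ v), fun u hu v hv mu mv huv => h₁ u hu v hv mu mv ?_, fun i => ?_⟩
    · simpa using huv
    · rw [← hπ i]
      simp only [Equiv.symm_apply_eq]
  have : Nonempty (Fin X.k) := ⟨⟨0, hk⟩⟩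
  choose! φ h₁ h₂ using hφ
  have hsel : ∀ v, ∃ c : Fin X.k, v < X.n → ∀ j < 3, X.Mem (P j) v → φ j v = c := by
    intro v
    by_cases hc : v < X.n ∧ ∃ j < 3, X.Mem (P j) v
    · obtain ⟨hv, j, hj, mj⟩ := hc
      exact ⟨φ j v, fun _ i hi mi => by rw [h.eq hi hj hv mi mj]⟩
    · exact ⟨⟨0, hk⟩, fun hv j hj mj => absurd ⟨hv, j, hj, mj⟩ hc⟩
  choose ψ hψ using hsel
  have hθ : ∀ i, ∀ j < 3, X.prj j (g i) = X.typ (P j) fun v => ψ v = i := by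
    intro i j hj
    rw [← h₂ j hj i]
    exact typ_congr fun v hv mv => by rw [hψ v hv j hj mv]
  refine ⟨ψ, fun u hu v hv mu mv huv => ?_, ?_⟩
  · obtain ⟨i, hi, mi⟩ := (h.mem_iff hu).1 mu
    obtain ⟨j, hj, mj⟩ := (h.mem_iff hv).1 mv
    by_cases hij : i = j
    · subst hij
      refine h₁ i hi u hu v hv mi mj ?_
      rw [hψ u hu i hi mi, hψ v hv i hi mj, huv]
    · exact (allowed_iff hw hadj h (hθ (ψ v))).1 (ha _ (hg (ψ v)).1 (hg (ψ v)).2) j hj v hv mj rfl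
        i hi hij u hu mi huv
  · rw [← hsum fun x => (X.n + 1) ^ X.res t P x]
    exact Finset.sum_congr rfl fun i _ => congrArg _ (typ_eq_res hw hadj h (hθ i)).symm

/-- Every coloring of the union arises by merging its restrictions to the parts. -/
theorem exists_merge_of_good (hkn : X.k ≤ X.n) {s : ℕ} (hs : X.Good t s) :
    ∃ M < (X.n + 1) ^ 2 ^ (6 * X.width),
      ∑ x ∈ Finset.range (2 ^ (6 * X.width)), digit (X.n + 1) M x = X.k ∧
      (∀ x < 2 ^ (6 * X.width), digit (X.n + 1) M x ≠ 0 → X.Allowed P x) ∧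
      (∀ j < 3, X.Good (P j) (∑ x ∈ Finset.range (2 ^ (6 * X.width)),
        digit (X.n + 1) M x * (X.n + 1) ^ X.prj j x)) ∧
      s = ∑ x ∈ Finset.range (2 ^ (6 * X.width)),
        digit (X.n + 1) M x * (X.n + 1) ^ X.res t P x := by
  obtain ⟨φ, h₁, h₂⟩ := hs
  choose g hgL hθ using fun i : Fin X.k =>
    exists_prj (X := X) (fun j => X.typ (P j) fun v => φ v = i) fun j => typ_lt _ _
  have hk : X.k < X.n + 1 := Nat.lt_succ_of_le hkn
  have hsum : ∀ f : ℕ → ℕ, ∑ x ∈ Finset.range (2 ^ (6 * X.width)),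
      digit (X.n + 1) (code (X.n + 1) g) x * f x = ∑ i, f (g i) := fun f => by
    rw [sum_eq_sum_card hgL]
    exact Finset.sum_congr rfl fun x _ => by rw [digit_code hk]
  refine ⟨code (X.n + 1) g, code_lt hk hgL, ?_, fun x hx hd => ?_, fun j hj => ⟨φ, ?_, ?_⟩, ?_⟩
  · simpa using hsum fun _ => 1
  · rw [digit_code hk, Finset.card_ne_zero] at hd
    obtain ⟨i, hi⟩ := hd
    obtain rfl : g i = x := by simpa using hi
    rw [allowed_iff hw hadj h (hθ i)]
    intro j hj v hv mv sv i' hi' hij u hu mu su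
    exact h₁ u hu v hv ((h.mem_iff hu).2 ⟨_, hi', mu⟩) ((h.mem_iff hv).2 ⟨_, hj, mv⟩)
      (su.trans sv.symm)
  · exact fun u hu v hv mu mv => h₁ u hu v hv ((h.mem_iff hu).2 ⟨j, hj, mu⟩)
      ((h.mem_iff hv).2 ⟨j, hj, mv⟩)
  · rw [hsum fun x => (X.n + 1) ^ X.prj j x]
    exact Finset.sum_congr rfl fun i _ => by rw [hθ i j hj]
  · rw [hsum fun x => (X.n + 1) ^ X.res t P x, h₂]
    exact Finset.sum_congr rfl fun i _ => congrArg _ (typ_eq_res hw hadj h (hθ i))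

end Merge

end Inst

end FallRam

/-! ### The table -/

namespace FallRam

/-- The support of the table `F` is contained in that of `F'`. -/
def Le (F F' : ℕ → ℕ) : Prop := ∀ i, F i ≠ 0 → F' i ≠ 0

theorem Le.refl (F : ℕ → ℕ) : Le F F := fun _ h => h

theorem Le.trans {F F' F'' : ℕ → ℕ} (h : Le F F') (h' : Le F' F'') : Le F F'' :=
  fun i hi => h' i (h i hi)

theorem iter_induction {A : Type} {Inv : A → Prop} {a : A} {s : A → ℕ → A} {m : ℕ} (h₀ : Inv a)
    (hs : ∀ i < m, ∀ x, Inv x → Inv (s x i)) : Inv (iter a s m) := by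
  induction m with
  | zero => exact h₀
  | succ m ih => exact hs m (by omega) _ (ih fun i hi => hs i (by omega))

theorem le_iter {a : ℕ → ℕ} {s : (ℕ → ℕ) → ℕ → (ℕ → ℕ)} (hs : ∀ x i, Le x (s x i)) (m : ℕ) :
    Le a (iter a s m) :=
  iter_induction (Inv := Le a) (Le.refl a) fun i _ x hx => hx.trans (hs x i)

/-- What one step of an increasing iteration marks is marked in the end. -/
theorem iter_ne_zero {a : ℕ → ℕ} {s : (ℕ → ℕ) → ℕ → (ℕ → ℕ)} {m i c : ℕ}
    (hs : ∀ x i, Le x (s x i)) (hi : i < m) (h : ∀ x, Le a x → s x i c ≠ 0) :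
    iter a s m c ≠ 0 := by
  induction m with
  | zero => omega
  | succ m ih =>
    by_cases him : i = m
    · exact him ▸ h _ (le_iter hs _)
    · exact hs _ _ c (ih (by omega))

theorem bitsum_eq_two_pow {m c : ℕ} {P : ℕ → Prop} (hc : c < m) (h : ∀ a, P a ↔ a = c) :
    bitsum m P = 2 ^ c := by
  rw [bitsum, Finset.sum_eq_single c]
  · rw [ind_of ((h c).2 rfl), one_mul]
  · intro b _ hb
    rw [ind_of_not (mt (h b).1 hb), zero_mul]
  · intro hm
    exact absurd (Finset.mem_range.2 hc) hm

namespace Inst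

variable (X : Inst)

/-- The code `s` is recorded for the part `p`: for nodes in the table `F`, for other parts by a
formula. -/
def Fact (B : ℕ) (F : ℕ → ℕ) (p s : ℕ) : Prop :=
  (p < X.N ∧ F (p * B + s) ≠ 0) ∨
    (¬ p < X.N ∧ p < X.N + X.n ∧ s = X.n + 1 + (X.k - 1) * (X.n + 1) ^ 2 ^ X.width) ∨
    (¬ p < X.N + X.n ∧ s = X.k)

/-- The sequence `p₀`, `p₁`, `p₂` of parts. -/
def parts (p₀ p₁ p₂ j : ℕ) : ℕ := if j = 0 then p₀ else if j = 1 then p₁ else p₂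

/-- The code of the multiset of entries `j` of the multiset of triples with code `M`. -/
noncomputable def marginal (j M : ℕ) : ℕ := ∑ x ∈ Finset.range (2 ^ (6 * X.width)),
  digit (X.n + 1) M x * (X.n + 1) ^ X.prj j x

/-- The code of the multiset of types in `t` obtained from the multiset of triples with code
`M`. -/
noncomputable def merged (t : ℕ) (P : ℕ → ℕ) (M : ℕ) : ℕ :=
  ∑ x ∈ Finset.range (2 ^ (6 * X.width)), digit (X.n + 1) M x * (X.n + 1) ^ X.res t P x

/-- The multiset of triples with code `M` describes how recorded colorings of the parts `P j`
combine to a coloring of the node `t`. -/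
def Guard (B : ℕ) (F : ℕ → ℕ) (t : ℕ) (P : ℕ → ℕ) (M : ℕ) : Prop :=
  t < X.N ∧ X.Splits t P ∧
    ∑ x ∈ Finset.range (2 ^ (6 * X.width)), digit (X.n + 1) M x = X.k ∧
    (∀ x < 2 ^ (6 * X.width), digit (X.n + 1) M x ≠ 0 → X.Allowed P x) ∧
    ∀ j < 3, X.Fact B F (P j) (X.marginal j M)

/-- Record the coloring of `t` described by `M`. -/
noncomputable def mark (B : ℕ) (F : ℕ → ℕ) (t : ℕ) (P : ℕ → ℕ) (M : ℕ) : ℕ → ℕ :=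
  if ind (X.Guard B F t P M) ≠ 0 then Function.update F (t * B + X.merged t P M) 1 else F

/-- Try all nodes, all triples of parts, and all multisets of triples of types. -/
noncomputable def round (B : ℕ) (F : ℕ → ℕ) : ℕ → ℕ :=
  iter F (fun F t => iter F (fun F p₀ => iter F (fun F p₁ => iter F (fun F p₂ =>
    iter F (fun F M => X.mark B F t (parts p₀ p₁ p₂) M) B) B) B) B) B

/-- The table after `m` rounds. -/
noncomputable def table (B m : ℕ) : ℕ → ℕ := iter (fun _ => 0) (fun F _ => X.round B F) m

/-- The properties of an instance on which the correctness of the table depends. The function `h`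
is a measure that witnesses that the recursion is well founded. -/
structure Valid (B : ℕ) (h : ℕ → ℕ) : Prop where
  width_pos : 0 < X.width
  symm : ∀ u v, X.adj u v → X.adj v u
  irrefl : ∀ v < X.n, ¬ X.adj v v
  k_pos : 0 < X.k
  k_le : X.k ≤ X.n
  le_bound : (X.n + 1) ^ 2 ^ (6 * X.width) ≤ B
  add_lt_bound : X.N + X.n < B
  measure_lt : ∀ t < X.N, h t < B
  splits : ∀ t < X.N, ∃ p₀ ≤ X.N + X.n, ∃ p₁ ≤ X.N + X.n, ∃ p₂ ≤ X.N + X.n,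
    X.Splits t (parts p₀ p₁ p₂) ∧
    ∀ j < 3, parts p₀ p₁ p₂ j < X.N → h (parts p₀ p₁ p₂ j) < h t

variable {X} {B : ℕ} {h : ℕ → ℕ} {F F' : ℕ → ℕ}

theorem Fact.mono (hF : Le F F') {p s : ℕ} (hf : X.Fact B F p s) : X.Fact B F' p s :=
  hf.imp_left fun a => ⟨a.1, hF _ a.2⟩

theorem Guard.mono (hF : Le F F') {t M : ℕ} {P : ℕ → ℕ} (hg : X.Guard B F t P M) :
    X.Guard B F' t P M :=
  ⟨hg.1, hg.2.1, hg.2.2.1, hg.2.2.2.1, fun j hj => (hg.2.2.2.2 j hj).mono hF⟩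

theorem le_mark (t M : ℕ) (P : ℕ → ℕ) : Le F (X.mark B F t P M) := by
  intro i hi
  unfold mark
  split_ifs
  · by_cases h : i = t * B + X.merged t P M
    · simp [h]
    · rwa [Function.update_of_ne h]
  · exact hi

theorem round_ne_zero {t p₀ p₁ p₂ M : ℕ} (ht : t < B) (h₀ : p₀ < B) (h₁ : p₁ < B) (h₂ : p₂ < B)
    (hM : M < B) (hg : X.Guard B F t (parts p₀ p₁ p₂) M) :
    X.round B F (t * B + X.merged t (parts p₀ p₁ p₂) M) ≠ 0 := by
  refine iter_ne_zero (fun _ _ => le_iter (fun _ _ => le_iter (fun _ _ => le_iter (fun _ _ =>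
    le_iter (fun _ _ => le_mark _ _ _) _) _) _) _) ht fun F₁ l₁ => ?_
  refine iter_ne_zero (fun _ _ => le_iter (fun _ _ => le_iter (fun _ _ =>
    le_iter (fun _ _ => le_mark _ _ _) _) _) _) h₀ fun F₂ l₂ => ?_
  refine iter_ne_zero (fun _ _ => le_iter (fun _ _ =>
    le_iter (fun _ _ => le_mark _ _ _) _) _) h₁ fun F₃ l₃ => ?_
  refine iter_ne_zero (fun _ _ => le_iter (fun _ _ => le_mark _ _ _) _) h₂ fun F₄ l₄ => ?_
  refine iter_ne_zero (fun _ _ => le_mark _ _ _) hM fun F₅ l₅ => ?_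
  have := hg.mono ((((l₁.trans l₂).trans l₃).trans l₄).trans l₅)
  rw [mark, if_pos (ind_ne_zero.2 this), Function.update_self]
  exact one_ne_zero

/-- An invariant of the marking steps is an invariant of the table. -/
theorem table_induction {Inv : (ℕ → ℕ) → Prop} (h₀ : Inv fun _ => 0)
    (hs : ∀ F t P M, Inv F → Inv (X.mark B F t P M)) (m : ℕ) : Inv (X.table B m) :=
  iter_induction h₀ fun _ _ _ h => iter_induction h fun _ _ _ h => iter_induction h fun _ _ _ h =>
    iter_induction h fun _ _ _ h => iter_induction h fun _ _ _ h => iter_induction h fun _ _ _ h =>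
    hs _ _ _ _ h

theorem cls_eq_zero {v : ℕ} (hv : v < X.n) : X.cls (X.N + v) v = 0 := by
  refine Finset.sum_eq_zero fun u hu => ind_of_not ?_
  rintro ⟨h, h'⟩
  have hm : X.Mem (X.N + v) v := Or.inr ⟨by omega, rfl⟩
  obtain rfl : u = v := by
    rcases h.1 with h | h <;> omega
  exact h' u (by omega) hm (Eqv.refl _ _)

theorem mem_add_iff {u v : ℕ} : X.Mem (X.N + v) u ↔ u = v := by
  constructor
  · rintro (h | h) <;> omega
  · rintro rfl
    exact Or.inr ⟨by omega, rfl⟩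

/-- In the part `{v}`, the set `S` either meets the only class or leaves it undominated. -/
theorem typ_add (hw : 0 < X.width) {v : ℕ} (hv : v < X.n) (S : ℕ → Prop) [Decidable (S v)] :
    X.typ (X.N + v) S = if S v then 1 else 2 ^ X.width := by
  have key : ∀ a, (∃ u < X.n, X.Mem (X.N + v) u ∧ ((a = X.cls (X.N + v) u ∧ S u) ∨
      (a = X.width + X.cls (X.N + v) u ∧ ¬ S u ∧
        ∀ x < X.n, X.Mem (X.N + v) x → S x → ¬ X.adj x u))) ↔
      (a = 0 ∧ S v) ∨ (a = X.width ∧ ¬ S v) := by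
    intro a
    simp only [mem_add_iff]
    constructor
    · rintro ⟨u, hu, rfl, h | h⟩
      · exact Or.inl ⟨h.1.trans (cls_eq_zero hu), h.2⟩
      · exact Or.inr ⟨by rw [h.1, cls_eq_zero hu, add_zero], h.2.1⟩
    · rintro (⟨ha, hs⟩ | ⟨ha, hs⟩)
      · exact ⟨v, hv, rfl, Or.inl ⟨by rw [cls_eq_zero hv, ha], hs⟩⟩
      · refine ⟨v, hv, rfl, Or.inr ⟨by rw [cls_eq_zero hv, ha, add_zero], hs, ?_⟩⟩
        rintro x _ rfl hx
        exact absurd hx hs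
  split_ifs with hs
  · exact (bitsum_eq_two_pow (c := 0) (by omega) fun a => (key a).trans (by simp [hs])).trans rfl
  · exact bitsum_eq_two_pow (by omega) fun a => (key a).trans (by simp [hs])

/-- The formulas for parts that are not nodes are correct. -/
theorem Valid.fact_iff (hX : X.Valid B h) {p s : ℕ} (hp : ¬ p < X.N) :
    X.Fact B F p s ↔ X.Good p s := by
  have hf : X.Fact B F p s ↔
      s = if p < X.N + X.n then X.n + 1 + (X.k - 1) * (X.n + 1) ^ 2 ^ X.width else X.k := by
    unfold Fact
    split_ifs with hpn <;> simp [hp, hpn]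
  rw [hf]
  have hc : ∀ φ : ℕ → Fin X.k, (code (X.n + 1) fun i => X.typ p fun v => φ v = i) =
      if p < X.N + X.n then X.n + 1 + (X.k - 1) * (X.n + 1) ^ 2 ^ X.width else X.k := by
    intro φ
    split_ifs with hpn
    · obtain ⟨v, rfl⟩ : ∃ v, p = X.N + v := ⟨p - X.N, by omega⟩
      have hv : v < X.n := by omega
      simp only [code, typ_add hX.width_pos hv]
      rw [← Finset.add_sum_erase _ _ (Finset.mem_univ (φ v)), if_pos rfl, pow_one,
        Finset.sum_congr rfl (g := fun _ => (X.n + 1) ^ 2 ^ X.width), Finset.sum_const,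
        Finset.card_erase_of_mem (Finset.mem_univ _), Finset.card_univ, Fintype.card_fin,
        smul_eq_mul]
      intro i hi
      rw [if_neg (Finset.ne_of_mem_erase hi).symm]
    · have : ∀ i, (X.typ p fun v => φ v = i) = 0 := by
        intro i
        rw [typ, bitsum]
        refine Finset.sum_eq_zero fun a _ => ?_
        rw [ind_of_not, zero_mul]
        rintro ⟨v, hv, h | h, -⟩ <;> omega
      simp [code, this]
  constructor
  · intro hs
    refine ⟨fun _ => ⟨0, hX.k_pos⟩, fun u hu v hv mu mv _ => ?_, hs.trans (hc _).symm⟩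
    obtain rfl : u = v := by rcases mu with h | h <;> rcases mv with h' | h' <;> omega
    exact hX.irrefl u hu
  · rintro ⟨φ, -, hs⟩
    exact hs.trans (hc φ)

theorem Valid.pow_width_le (hX : X.Valid B h) {a : ℕ} (ha : a ≤ 6 * X.width) :
    (X.n + 1) ^ 2 ^ a ≤ B :=
  (Nat.pow_le_pow_right (by omega) (Nat.pow_le_pow_right (by omega) ha)).trans hX.le_bound

theorem Valid.lt_of_good (hX : X.Valid B h) {t s : ℕ} (hg : X.Good t s) : s < B := by
  obtain ⟨φ, -, rfl⟩ := hg
  exact (code_lt (Nat.lt_succ_of_le hX.k_le) fun i => typ_lt _ _).trans_le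
    (hX.pow_width_le (by omega))

/-- Everything that is recorded is true. -/
theorem Valid.good_of_table (hX : X.Valid B h) (m : ℕ) :
    ∀ t s, s < B → X.table B m (t * B + s) ≠ 0 → X.Good t s := by
  refine table_induction (Inv := fun F => ∀ t s, s < B → F (t * B + s) ≠ 0 → X.Good t s)
    (fun _ _ _ h => absurd rfl h) (fun F t P M hF => ?_) m
  unfold mark
  split_ifs with hg
  · obtain ⟨g₁, g₂, g₃, g₄, g₅⟩ := ind_ne_zero.1 hg
    have hP : ∀ j < 3, X.Good (P j) (X.marginal j M) := by
      intro j hj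
      by_cases hp : P j < X.N
      · have hlt : X.marginal j M < B := by
          obtain ⟨g, -, hsum⟩ := exists_of_sum_eq g₃
          rw [marginal, ← hsum fun x => (X.n + 1) ^ X.prj j x]
          exact (code_lt (Nat.lt_succ_of_le hX.k_le) fun i => prj_lt j (g i)).trans_le
            (hX.pow_width_le (by omega))
        rcases g₅ j hj with h' | h' | h'
        · exact hF _ _ hlt h'.2
        · exact absurd hp h'.1
        · exact absurd (by omega) h'.1
      · exact (hX.fact_iff hp).1 (g₅ j hj)
    have hgood : X.Good t (X.merged t P M) :=
      good_of_merge hX.width_pos hX.symm g₂ hX.k_pos hX.k_le g₃ g₄ hP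
    have hlt := hX.lt_of_good hgood
    intro t' s' hs' hne
    -- Codes are below `B`, so the address of a cell determines the node and the code.
    by_cases heq : t' * B + s' = t * B + X.merged t P M
    · have hB : 0 < B := by omega
      have e₁ := congrArg (· / B) heq
      simp only [mul_comm _ B, Nat.mul_add_div hB, Nat.div_eq_of_lt hs', Nat.div_eq_of_lt hlt,
        add_zero] at e₁
      subst e₁
      rwa [Nat.add_left_cancel heq]
    · rw [Function.update_of_ne heq] at hne
      exact hF _ _ hs' hne
  · exact hF

/-- Every true fact is recorded, after as many rounds as the measure of the node says. -/
theorem Valid.table_of_good (hX : X.Valid B h) (m : ℕ) :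
    ∀ t < X.N, h t < m → ∀ s, X.Good t s → X.table B m (t * B + s) ≠ 0 := by
  induction m with
  | zero => intro t _ ht; omega
  | succ m ih =>
    intro t ht hm s hs
    obtain ⟨p₀, h₀, p₁, h₁, p₂, h₂, hsp, hlt⟩ := hX.splits t ht
    obtain ⟨M, hM, g₁, g₂, g₃, rfl⟩ := exists_merge_of_good hX.width_pos hX.symm hsp hX.k_le hs
    have hB := hX.add_lt_bound
    refine round_ne_zero (F := X.table B m) (by omega) (by omega) (by omega) (by omega)
      (hM.trans_le hX.le_bound) ⟨ht, hsp, g₁, g₂, fun j hj => ?_⟩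
    by_cases hp : parts p₀ p₁ p₂ j < X.N
    · exact Or.inl ⟨hp, ih _ hp (by have := hlt j hj hp; omega) _ (g₃ j hj)⟩
    · exact (hX.fact_iff hp).2 (g₃ j hj)

theorem Valid.table_iff (hX : X.Valid B h) {t s : ℕ} (ht : t < X.N) (hs : s < B) :
    X.table B B (t * B + s) ≠ 0 ↔ X.Good t s :=
  ⟨hX.good_of_table B t s hs, hX.table_of_good B t ht (hX.measure_lt t ht) s⟩

/-- The fall colorings are the proper colorings none of whose color classes leaves a vertex
undominated, that is, all of whose types are small. -/
theorem Valid.exists_good_iff (hX : X.Valid B h) {t : ℕ} (ht : ∀ v < X.n, X.Mem t v) :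
    (∃ s < (X.n + 1) ^ 2 ^ X.width, X.Good t s) ↔ ∃ φ : ℕ → Fin X.k,
      (∀ u < X.n, ∀ v < X.n, φ u = φ v → ¬ X.adj u v) ∧
      ∀ i, ∀ v < X.n, φ v ≠ i → ∃ u < X.n, φ u = i ∧ X.adj u v := by
  have hk : X.k < X.n + 1 := Nat.lt_succ_of_le hX.k_le
  constructor
  · rintro ⟨s, hs, φ, h₁, h₂⟩
    refine ⟨φ, fun u hu v hv => h₁ u hu v hv (ht u hu) (ht v hv), fun i v hv hvi => ?_⟩
    by_contra! hc
    have hbit : Bit (X.typ t fun v => φ v = i) (X.width + X.cls t v) :=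
      (bit_typ_width_add hX.width_pos hv (ht v hv)).2
        ⟨v, hv, ht v hv, Eqv.refl _ _, hvi, fun x hx _ => hc x hx⟩
    have h₃ : (X.n + 1) ^ (X.typ t fun v => φ v = i) ≤ s := by
      rw [h₂]
      exact Finset.single_le_sum (f := fun i => (X.n + 1) ^ (X.typ t fun v => φ v = i))
        (fun _ _ => Nat.zero_le _) (Finset.mem_univ i)
    have h₄ := (Nat.pow_le_pow_right (n := 2) (by omega) (Nat.le_add_right X.width
      (X.cls t v))).trans hbit.two_pow_le
    have h₅ := Nat.pow_le_pow_right (n := X.n + 1) (by omega) h₄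
    omega
  · rintro ⟨φ, h₁, h₂⟩
    refine ⟨_, ?_, φ, fun u hu v hv _ _ => h₁ u hu v hv, rfl⟩
    refine code_lt hk fun i => ?_
    have : (X.typ t fun v => φ v = i) = bitsum X.width fun a =>
        ∃ v < X.n, a = X.cls t v ∧ φ v = i := by
      refine (Finset.sum_subset_zero_on_sdiff (Finset.range_subset_range.2 (by omega)) ?_ ?_).symm
      · intro a ha
        rw [Finset.mem_sdiff, Finset.mem_range, Finset.mem_range] at ha
        rw [ind_of_not, zero_mul]
        rintro ⟨v, hv, mv, ⟨hc, -⟩ | ⟨-, hvi, hd⟩⟩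
        · exact ha.2 (hc ▸ cls_lt_width hX.width_pos hv mv)
        · obtain ⟨u, hu, hui, huv⟩ := h₂ i v hv hvi
          exact hd u hu (ht u hu) hui huv
      · intro a ha
        rw [Finset.mem_range] at ha
        congr 2
        refine propext (exists_congr fun v => and_congr_right fun hv => ?_)
        constructor
        · exact fun h => ⟨ht v hv, Or.inl h⟩
        · rintro ⟨-, h | h⟩
          · exact h
          · omega
    rw [this]
    exact bitsum_lt _ _

end Inst

end FallRam

/-! ### Rooted trees -/

namespace RootedTreeOn

variable {τ : Type*} (T : RootedTreeOn τ)

theorem iterate_root (i : ℕ) : T.parent^[i] T.root = T.root :=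
  Function.iterate_fixed T.parent_root i

/-- There are no cycles of parents except at the root. -/
theorem eq_root_of_iterate_eq {t : τ} {m : ℕ} (hm : 0 < m) (h : T.parent^[m] t = t) :
    t = T.root := by
  obtain ⟨i, hi⟩ := T.reaches_root t
  have h₁ : T.parent^[m * i] t = t := by
    rw [Function.iterate_mul]
    exact Function.iterate_fixed h i
  have h₂ : m * i = (m * i - i) + i := by
    have := Nat.le_mul_of_pos_left i hm
    omega
  rw [h₂, Function.iterate_add_apply, hi, iterate_root] at h₁
  exact h₁.symm

theorem mem_subtree_iff {s t : τ} :
    s ∈ T.subtree t ↔ s = t ∨ ∃ c, c ≠ t ∧ T.parent c = t ∧ s ∈ T.subtree c := by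
  classical
  constructor
  · intro h
    have hi : T.parent^[Nat.find h] s = t := Nat.find_spec h
    cases hf : Nat.find h with
    | zero => rw [hf] at hi; exact Or.inl hi
    | succ i =>
      rw [hf, Function.iterate_succ_apply'] at hi
      exact Or.inr ⟨_, Nat.find_min h (by omega), hi, i, rfl⟩
  · rintro (rfl | ⟨c, -, rfl, i, rfl⟩)
    · exact ⟨0, rfl⟩
    · exact ⟨i + 1, Function.iterate_succ_apply' _ _ _⟩

theorem self_mem_subtree (t : τ) : t ∈ T.subtree t := ⟨0, rfl⟩

theorem notMem_subtree_child {c t : τ} (hc : c ≠ t) (h : T.parent c = t) : t ∉ T.subtree c := by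
  rintro ⟨i, hi⟩
  have ht := T.eq_root_of_iterate_eq (t := t) (m := i + 1) (by omega)
    (by rw [Function.iterate_succ_apply', hi, h])
  rw [ht, iterate_root] at hi
  exact hc (hi.symm.trans ht.symm)

/-- The subtrees of different children are disjoint. -/
theorem child_eq {c d s t : τ} (hc : c ≠ t) (hd : d ≠ t) (h : T.parent c = t) (h' : T.parent d = t)
    (hs : s ∈ T.subtree c) (hs' : s ∈ T.subtree d) : c = d := by
  obtain ⟨i, hi⟩ := hs
  obtain ⟨j, hj⟩ := hs'
  have key : ∀ {c d : τ} {i j : ℕ}, c ≠ t → d ≠ t → T.parent c = t → T.parent d = t →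
      T.parent^[i] s = c → T.parent^[j] s = d → i < j → False := by
    intro c d i j hc hd h h' hi hj hij
    refine T.notMem_subtree_child hd h' ⟨j - i - 1, ?_⟩
    rw [← h, ← hi, ← Function.iterate_succ_apply' T.parent, ← Function.iterate_add_apply,
      show j - i - 1 + (i + 1) = j by omega, hj]
  rcases lt_trichotomy i j with hij | rfl | hij
  · exact (key hc hd h h' hi hj hij).elim
  · exact hi.symm.trans hj
  · exact (key hd hc h' h hj hi hij).elim

variable [Fintype τ]

theorem ncard_subtree_lt {c t : τ} (hc : c ≠ t) (h : T.parent c = t) :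
    (T.subtree c).ncard < (T.subtree t).ncard := by
  refine Set.ncard_lt_ncard ?_ (Set.toFinite _)
  refine ⟨fun s hs => T.mem_subtree_iff.2 (Or.inr ⟨c, hc, h, hs⟩), fun hs => ?_⟩
  exact T.notMem_subtree_child hc h (hs (T.self_mem_subtree t))

open Classical in
/-- The children of a node. -/
noncomputable def children (t : τ) : Finset τ := Finset.univ.filter fun c => c ≠ t ∧ T.parent c = t

theorem mem_children {c t : τ} : c ∈ T.children t ↔ c ≠ t ∧ T.parent c = t := by
  simp [children]

theorem card_children_le (t : τ) : (T.children t).card ≤ T.degree t := by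
  rw [← Set.ncard_coe_finset]
  refine Set.ncard_le_ncard (fun c hc => ?_) (Set.toFinite _)
  have := T.mem_children.1 hc
  exact ⟨this.1, Or.inl this.2⟩

/-- A node with a smallest subtree is a leaf. -/
theorem exists_isLeaf : ∃ t, T.IsLeaf t := by
  obtain ⟨t, -, ht⟩ := Finset.exists_min_image Finset.univ (fun t => (T.subtree t).ncard)
    ⟨T.root, Finset.mem_univ _⟩
  refine ⟨t, (Set.ncard_le_ncard (t := {T.parent t}) ?_ (Set.toFinite _)).trans
    (Set.ncard_singleton _).le⟩
  rintro s ⟨hs, h | h⟩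
  · exact absurd (T.ncard_subtree_lt hs h) (not_lt.2 (ht s (Finset.mem_univ _)))
  · exact h.symm

/-- The path from a node to an ancestor has fewer edges than there are nodes, so a bounded search
suffices to find it. -/
theorem exists_iterate_lt {s t : τ} (h : s ∈ T.subtree t) :
    ∃ i < Fintype.card τ, T.parent^[i] s = t := by
  classical
  refine ⟨Nat.find h, ?_, Nat.find_spec h⟩
  by_contra! hc
  obtain ⟨i, j, hij, he⟩ := Fintype.exists_ne_map_eq_of_card_lt
    (fun i : Fin (Nat.find h + 1) => T.parent^[(i : ℕ)] s) (by simp; omega)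
  wlog hlt : i < j generalizing i j
  · exact this j i hij.symm he.symm (lt_of_le_of_ne (not_lt.1 hlt) hij.symm)
  have hlt' : (i : ℕ) < j := hlt
  refine Nat.find_min h (m := Nat.find h - j + i) (by omega) ?_
  change T.parent^[i] s = T.parent^[j] s at he
  rw [Function.iterate_add_apply, he, ← Function.iterate_add_apply,
    show Nat.find h - j + j = Nat.find h by omega]
  exact Nat.find_spec h

end RootedTreeOn

/-! ### The instance in memory -/

namespace FallRam

/-- The instance that is stored in the memory `e`. Adjacency is restricted to pairs of vertices, as
`u * n + v` may be the index of another pair otherwise. -/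
def inst (e : RamStore) : Inst where
  n := e 0 0
  k := e 0 1
  N := e 0 2
  root := e 0 3
  adj u v := (u < e 0 0 ∧ v < e 0 0) ∧ e 1 (u * e 0 0 + v) ≠ 0
  par := e 2
  leaf := e 3

section Input

variable {n N : ℕ} (G : SimpleGraph (Fin n)) (D : RootedBranchDecomposition (Fin n) (Fin N))
  (k : ℕ)

/-- The instance given by a graph, a decomposition and a number of colors. -/
noncomputable def input : Inst := inst (fallColInput G D k)

theorem input_n : (input G D k).n = n := rfl

theorem input_N : (input G D k).N = N := rfl

open Classical in
theorem input_adj (u v : Fin n) : (input G D k).adj u v ↔ G.Adj u v := by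
  have h : (input G D k).adj u v ↔ ((u : ℕ) < n ∧ (v : ℕ) < n) ∧
      (if ∃ u' v' : Fin n, G.Adj u' v' ∧ (u * n + v : ℕ) = u' * n + v' then 1 else 0) ≠ 0 := Iff.rfl
  rw [h]
  simp only [u.2, v.2, and_self, true_and, ne_eq, ite_eq_right_iff, one_ne_zero, imp_false,
    not_not]
  constructor
  · rintro ⟨u', v', h, he⟩
    have hn : 0 < n := u.pos
    have hu : (u : ℕ) = u' := by
      have := congrArg (· / n) he
      simpa [mul_comm _ n, Nat.mul_add_div hn, Nat.div_eq_of_lt] using this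
    obtain rfl : u = u' := Fin.ext hu
    obtain rfl : v = v' := Fin.ext (Nat.add_left_cancel he)
    exact h
  · exact fun h => ⟨u, v, h, rfl⟩

theorem input_leaf (v : Fin n) : (input G D k).leaf v = (D.leafEquiv v : Fin N) := by
  have h : (input G D k).leaf v =
      if h : (v : ℕ) < n then ((D.leafEquiv ⟨v, h⟩ : Fin N) : ℕ) else 0 := rfl
  rw [h, dif_pos v.2]

theorem input_par (t : Fin N) : (input G D k).par t = D.tree.parent t := by
  have h : (input G D k).par t =
      if h : (t : ℕ) < N then ((D.tree.parent ⟨t, h⟩ : Fin N) : ℕ) else 0 := rfl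
  rw [h, dif_pos t.2]

theorem input_iterate (i : ℕ) (t : Fin N) :
    (input G D k).par^[i] t = (D.tree.parent^[i] t : Fin N) := by
  induction i generalizing t with
  | zero => rfl
  | succ i ih => rw [Function.iterate_succ_apply, input_par, ih, Function.iterate_succ_apply]

theorem input_mem (t : Fin N) (v : Fin n) : (input G D k).Mem t v ↔ v ∈ D.verts t := by
  constructor
  · rintro (⟨-, i, -, hi⟩ | ⟨h, -⟩)
    · rw [input_leaf, input_iterate] at hi
      exact ⟨i, Fin.ext hi⟩
    · exact absurd t.2 h
  · intro h
    obtain ⟨i, hi, he⟩ := D.tree.exists_iterate_lt h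
    refine Or.inl ⟨t.2, i, by simpa [input_N] using hi, ?_⟩
    rw [input_leaf, input_iterate, he]

theorem input_mem_root (v : ℕ) (hv : v < n) : (input G D k).Mem (input G D k).root v :=
  (input_mem G D k D.tree.root ⟨v, hv⟩).2 (D.tree.reaches_root _)

include D in
theorem input_pos : 0 < n := by
  obtain ⟨t, ht⟩ := D.tree.exists_isLeaf
  exact (D.leafEquiv.symm ⟨t, ht⟩).pos

theorem input_eqv (t : Fin N) (u v : D.verts t) :
    (input G D k).Eqv t (u : Fin n) (v : Fin n) ↔ D.nbrSetoid G t u v := by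
  constructor
  · intro h
    ext x
    have := h x x.2
    rw [input_mem, input_adj, input_adj] at this
    simp only [Set.mem_inter_iff, SimpleGraph.mem_neighborSet, Set.mem_compl_iff]
    tauto
  · intro h x hx hm
    have hx' : x = (⟨x, hx⟩ : Fin n) := rfl
    rw [hx', input_mem] at hm
    rw [hx', input_adj, input_adj]
    have := Set.ext_iff.1 h ⟨x, hx⟩
    simp only [Set.mem_inter_iff, SimpleGraph.mem_neighborSet, Set.mem_compl_iff] at this
    tauto

theorem input_numCls_le (t : Fin N) :
    (input G D k).numCls t ≤ Nat.card (Quotient (D.nbrSetoid G t)) := by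
  classical
  have h : (input G D k).numCls t =
      Nat.card {u : Fin n // (input G D k).IsRep t u} := by
    rw [Nat.card_eq_fintype_card, Fintype.card_subtype, Finset.card_filter, Inst.numCls, input_n,
      ← Fin.sum_univ_eq_sum_range fun u => ind ((input G D k).IsRep t u)]
    exact Finset.sum_congr rfl fun u _ => by unfold ind; congr
  rw [h]
  refine Nat.card_le_card_of_injective
    (fun u : {u : Fin n // (input G D k).IsRep t u} => Quotient.mk (D.nbrSetoid G t)
    ⟨u.1, (input_mem G D k t u.1).1 u.2.1⟩) fun u v huv => ?_
  have he := (input_eqv G D k t _ _).2 (Quotient.exact huv)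
  refine Subtype.ext (Fin.ext ?_)
  rcases lt_trichotomy (u.1 : ℕ) v.1 with hlt | heq | hlt
  · exact absurd he (v.2.2 _ hlt u.2.1)
  · exact heq
  · exact absurd he.symm (u.2.2 _ hlt v.2.1)

theorem input_width_le : (input G D k).width ≤ D.moduleWidth G := by
  refine Finset.sup_le fun t ht => ?_
  have ht' : t < N := Finset.mem_range.1 ht
  exact (input_numCls_le G D k ⟨t, ht'⟩).trans
    (Finset.le_sup (f := fun t : Fin N => Nat.card (Quotient (D.nbrSetoid G t)))
      (Finset.mem_univ (⟨t, ht'⟩ : Fin N)))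

theorem input_width_pos : 0 < (input G D k).width := by
  have hn := input_pos D
  exact (Nat.zero_le _).trans_lt <| (Inst.cls_lt_numCls (X := input G D k) hn
    (input_mem_root G D k 0 hn)).trans_le (Finset.le_sup (Finset.mem_range.2 D.tree.root.2))

/-- At most three numbers are listed as a triple, with `z` in the unused places. -/
theorem exists_parts (Q : Finset ℕ) (hQ : Q.card ≤ 3) (z : ℕ) :
    ∃ p₀ ∈ insert z Q, ∃ p₁ ∈ insert z Q, ∃ p₂ ∈ insert z Q, ∀ f : ℕ → ℕ, f z = 0 →
      ∑ q ∈ Q, f q = ∑ j ∈ Finset.range 3, f (Inst.parts p₀ p₁ p₂ j) := by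
  simp only [Finset.sum_range_succ, Finset.sum_range_zero, Inst.parts]
  have : Q.card = 0 ∨ Q.card = 1 ∨ Q.card = 2 ∨ Q.card = 3 := by omega
  rcases this with h | h | h | h
  · rw [Finset.card_eq_zero] at h
    subst h
    exact ⟨z, by simp, z, by simp, z, by simp, fun f hf => by simp [hf]⟩
  · obtain ⟨a, rfl⟩ := Finset.card_eq_one.1 h
    exact ⟨a, by simp, z, by simp, z, by simp, fun f hf => by simp [hf]⟩
  · obtain ⟨a, b, hab, rfl⟩ := Finset.card_eq_two.1 h
    exact ⟨a, by simp, b, by simp, z, by simp, fun f hf => by simp [hf, Finset.sum_pair hab]⟩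
  · obtain ⟨a, b, c, hab, hac, hbc, rfl⟩ := Finset.card_eq_three.1 h
    refine ⟨a, by simp, b, by simp, c, by simp, fun f hf => ?_⟩
    rw [Finset.sum_insert (by simp [hab, hac]), Finset.sum_pair hbc]
    simp [add_assoc]

open Classical in
/-- The parts of which a node consists: its children, and its own vertex if it is a leaf. -/
noncomputable def nodeParts (t : Fin N) : Finset ℕ :=
  (D.tree.children t).image (fun c : Fin N => (c : ℕ)) ∪
    (Finset.univ.filter fun v : Fin n => (D.leafEquiv v : Fin N) = t).image
      fun v : Fin n => N + (v : ℕ)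

variable {D} in
theorem mem_nodeParts {t : Fin N} {q : ℕ} : q ∈ nodeParts D t ↔
    (∃ c ∈ D.tree.children t, (c : ℕ) = q) ∨
      ∃ v : Fin n, (D.leafEquiv v : Fin N) = t ∧ N + (v : ℕ) = q := by
  classical
  simp [nodeParts]

/-- A node has at most three children, and a leaf at most one. -/
theorem card_nodeParts_le (t : Fin N) : (nodeParts D t).card ≤ 3 := by
  classical
  refine (Finset.card_union_le _ _).trans ?_
  have h₁ := (Finset.card_image_le (s := D.tree.children t) (f := fun c : Fin N => (c : ℕ))).trans
    (D.tree.card_children_le t)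
  set S := Finset.univ.filter fun v : Fin n => (D.leafEquiv v : Fin N) = t with hS
  have h₂ := Finset.card_image_le (s := S) (f := fun v : Fin n => N + (v : ℕ))
  have h₃ : S.card ≤ 1 := by
    refine Finset.card_le_one.2 fun u hu v hv => D.leafEquiv.injective (Subtype.ext ?_)
    rw [hS, Finset.mem_filter] at hu hv
    exact hu.2.trans hv.2.symm
  rcases S.eq_empty_or_nonempty with h | ⟨v, hv⟩
  · have := D.subcubic t
    have h₀ : S.card = 0 := by rw [h, Finset.card_empty]
    omega
  · rw [hS, Finset.mem_filter] at hv
    have h₄ : D.tree.degree t ≤ 1 := hv.2 ▸ (D.leafEquiv v).2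
    omega

/-- The part `V_t` is the disjoint union of the parts of the node `t`. -/
theorem ind_mem_eq_sum (t : Fin N) (v : Fin n) :
    ind ((input G D k).Mem t v) = ∑ q ∈ nodeParts D t, ind ((input G D k).Mem q v) := by
  have hmem : ∀ u : Fin n, (input G D k).Mem (N + u) v ↔ v = u := fun u =>
    (Inst.mem_add_iff (X := input G D k)).trans Fin.val_inj
  by_cases hm : (input G D k).Mem t v
  · rw [ind_of hm]
    rw [input_mem] at hm
    rcases D.tree.mem_subtree_iff.1 hm with h | ⟨c, hc, hp, h⟩
    · rw [Finset.sum_eq_single (N + (v : ℕ)), ind_of ((hmem v).2 rfl)]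
      · intro q hq hqv
        refine ind_of_not fun hqm => ?_
        rcases mem_nodeParts.1 hq with ⟨c, hc, rfl⟩ | ⟨u, -, rfl⟩
        · rw [input_mem] at hqm
          rw [D.tree.mem_children] at hc
          exact D.tree.notMem_subtree_child hc.1 hc.2 (h ▸ hqm)
        · rw [(hmem u).1 hqm] at hqv
          exact hqv rfl
      · exact fun hq => absurd (mem_nodeParts.2 (Or.inr ⟨v, h, rfl⟩)) hq
    · rw [Finset.sum_eq_single (c : ℕ), ind_of ((input_mem G D k c v).2 h)]
      · intro q hq hqc
        refine ind_of_not fun hqm => ?_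
        rcases mem_nodeParts.1 hq with ⟨d, hd, rfl⟩ | ⟨u, hu, rfl⟩
        · rw [input_mem] at hqm
          rw [D.tree.mem_children] at hd
          exact hqc (congrArg Fin.val (D.tree.child_eq hd.1 hc hd.2 hp hqm h))
        · obtain rfl := (hmem u).1 hqm
          exact D.tree.notMem_subtree_child hc hp (hu ▸ h)
      · exact fun hq =>
          absurd (mem_nodeParts.2 (Or.inl ⟨c, D.tree.mem_children.2 ⟨hc, hp⟩, rfl⟩)) hq
  · rw [ind_of_not hm, eq_comm]
    refine Finset.sum_eq_zero fun q hq => ind_of_not fun hqm => hm ?_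
    rw [input_mem]
    rcases mem_nodeParts.1 hq with ⟨c, hc, rfl⟩ | ⟨u, hu, rfl⟩
    · rw [input_mem] at hqm
      rw [D.tree.mem_children] at hc
      exact D.tree.mem_subtree_iff.2 (Or.inr ⟨c, hc.1, hc.2, hqm⟩)
    · obtain rfl := (hmem u).1 hqm
      exact D.tree.mem_subtree_iff.2 (Or.inl hu)

open Classical in
/-- The size of the subtree of a node, and `0` for parts that are not nodes. -/
noncomputable def size (t : ℕ) : ℕ :=
  if h : t < N then (D.tree.subtree ⟨t, h⟩).ncard else 0

theorem size_coe (t : Fin N) : size D t = (D.tree.subtree t).ncard := dif_pos t.2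

theorem input_valid {B : ℕ} (hk : 0 < k) (hkn : k ≤ n)
    (hB : (n + 1) ^ 2 ^ (6 * (input G D k).width) ≤ B) (hB' : N + n < B) :
    (input G D k).Valid B (size D) where
  width_pos := input_width_pos G D k
  symm := by
    intro u v h
    have h₁ := input_adj G D k ⟨u, h.1.1⟩ ⟨v, h.1.2⟩
    have h₂ := input_adj G D k ⟨v, h.1.2⟩ ⟨u, h.1.1⟩
    exact h₂.2 (h₁.1 h).symm
  irrefl v hv := fun h => ((input_adj G D k ⟨v, hv⟩ ⟨v, hv⟩).1 h).ne rfl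
  k_pos := hk
  k_le := hkn
  le_bound := hB
  add_lt_bound := hB'
  measure_lt := by
    intro t ht
    refine (size_coe D ⟨t, ht⟩).trans_lt ?_
    refine (Set.ncard_le_card _).trans_lt ?_
    simp
    omega
  splits := by
    intro t ht
    lift t to Fin N using ht
    obtain ⟨p₀, h₀, p₁, h₁, p₂, h₂, hs⟩ := exists_parts _ (card_nodeParts_le D t) (N + n)
    have hle : ∀ p ∈ insert (N + n) (nodeParts D t), p ≤ N + n ∧ (p < N → size D p < size D t) := by
      intro p hp
      rcases Finset.mem_insert.1 hp with rfl | hp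
      · exact ⟨le_rfl, fun h => by omega⟩
      · rcases mem_nodeParts.1 hp with ⟨c, hc, rfl⟩ | ⟨u, hu, rfl⟩
        · rw [D.tree.mem_children] at hc
          refine ⟨by omega, fun _ => ?_⟩
          rw [size_coe, size_coe]
          exact D.tree.ncard_subtree_lt hc.1 hc.2
        · exact ⟨by omega, fun h => by omega⟩
    refine ⟨p₀, (hle _ h₀).1, p₁, (hle _ h₁).1, p₂, (hle _ h₂).1, fun v hv => ?_, fun j _ => ?_⟩
    · refine (ind_mem_eq_sum G D k t ⟨v, hv⟩).trans (hs (fun p => ind ((input G D k).Mem p v)) ?_)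
      have hv' : v < n := hv
      refine ind_of_not ?_
      rintro (h | h)
      · have : N + n < N := h.1
        omega
      · have : N + n = N + v := h.2
        omega
    · unfold Inst.parts
      split_ifs
      exacts [(hle _ h₀).2, (hle _ h₁).2, (hle _ h₂).2]

theorem hasFallColoring_iff : HasFallColoring G k ↔ ∃ φ : ℕ → Fin k,
    (∀ u < n, ∀ v < n, φ u = φ v → ¬ (input G D k).adj u v) ∧
    ∀ i, ∀ v < n, φ v ≠ i → ∃ u < n, φ u = i ∧ (input G D k).adj u v := by
  have hn := input_pos D
  constructor
  · rintro ⟨φ, hφ⟩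
    -- Beyond the vertices, the coloring is continued by the color of the last vertex.
    have hext : ∀ v (hv : v < n), φ ⟨min v (n - 1), by omega⟩ = φ ⟨v, hv⟩ := fun v hv => by
      congr 2; omega
    refine ⟨fun v => φ ⟨min v (n - 1), by omega⟩, fun u hu v hv h ha => ?_, fun i v hv h => ?_⟩
    · simp only [hext u hu, hext v hv] at h
      have ha' := (input_adj G D k ⟨u, hu⟩ ⟨v, hv⟩).1 ha
      exact (hφ (φ ⟨v, hv⟩)).2.1 h rfl ha'.ne ha'
    · simp only [hext v hv] at h
      obtain ⟨u, hu, ha⟩ := (hφ i).2.2 ⟨v, hv⟩ h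
      exact ⟨u, u.2, (hext u u.2).trans hu, (input_adj G D k u ⟨v, hv⟩).2 ha.symm⟩
  · rintro ⟨φ, h₁, h₂⟩
    refine ⟨fun v => φ v, fun i => ⟨?_, fun u hu v hv _ ha => ?_, fun v hv => ?_⟩⟩
    · by_cases h : φ 0 = i
      · exact ⟨⟨0, hn⟩, h⟩
      · obtain ⟨u, hu, hi, -⟩ := h₂ i 0 hn h
        exact ⟨⟨u, hu⟩, hi⟩
    · exact h₁ u u.2 v v.2 (Eq.trans hu (Eq.symm hv)) ((input_adj G D k u v).2 ha)
    · obtain ⟨u, hu, hi, ha⟩ := h₂ i v v.2 hv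
      exact ⟨⟨u, hu⟩, hi, ((input_adj G D k ⟨u, hu⟩ v).1 ha).symm⟩

variable {G} {k} in
include D in
theorem HasFallColoring.pos_and_le (h : HasFallColoring G k) : 0 < k ∧ k ≤ n := by
  obtain ⟨φ, hφ⟩ := h
  refine ⟨(φ ⟨0, input_pos D⟩).pos, ?_⟩
  have : Function.Surjective φ := fun i => (hφ i).1
  simpa using Fintype.card_le_of_surjective φ this

/-- The criterion that the program evaluates when the table is complete. -/
theorem hasFallColoring_iff_table {B : ℕ}
    (hB : (n + 1) ^ 2 ^ (6 * (input G D k).width) ≤ B) (hB' : N + n < B) :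
    HasFallColoring G k ↔ (0 < k ∧ k ≤ n) ∧ ∃ s < B,
      s < (n + 1) ^ 2 ^ (input G D k).width ∧
        (input G D k).table B B ((input G D k).root * B + s) ≠ 0 := by
  refine (and_iff_right_of_imp (HasFallColoring.pos_and_le D)).symm.trans
    (and_congr_right fun ⟨hk, hkn⟩ => ?_)
  have hX := input_valid G D k hk hkn hB hB'
  rw [hasFallColoring_iff G D k]
  refine (hX.exists_good_iff (input_mem_root G D k)).symm.trans ?_
  constructor
  · rintro ⟨s, hs, hg⟩
    have hsB := hX.lt_of_good hg
    exact ⟨s, hsB, hs, (hX.table_iff D.tree.root.2 hsB).2 hg⟩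
  · rintro ⟨s, hsB, hs, ht⟩
    exact ⟨s, hs, (hX.table_iff D.tree.root.2 hsB).1 ht⟩

end Input

end FallRam

/-! ### Computability of arithmetic and of bounded quantifiers -/

namespace FallRam

variable {V : Type} {Γ : Ctx V}

/-- Computability of the truth value of a predicate. -/
def CompP (Γ : Ctx V) (p : RamStore → V → Prop) : Prop := Comp Γ fun e v => ind (p e v)

section Logic

variable {p q : RamStore → V → Prop} {f g b : RamStore → V → ℕ}

theorem CompP.congr (hp : CompP Γ p) (h : ∀ e v, Γ.inv e v → (p e v ↔ q e v)) : CompP Γ q :=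
  Comp.congr hp fun e v hi => by rw [propext (h e v hi)]

theorem Comp.cond (hp : CompP Γ p) (hf : Comp Γ f) (hg : Comp Γ g) :
    Comp Γ (fun e v => if ind (p e v) ≠ 0 then f e v else g e v) := Comp.ite hp hf hg

theorem CompP.ne_zero (hf : Comp Γ f) : CompP Γ (fun e v => f e v ≠ 0) :=
  (Comp.ite hf (.const 1) (.const 0)).congr fun e v _ => by
    by_cases h : f e v ≠ 0
    · rw [ind_of h, if_pos h]
    · rw [ind_of_not h, if_neg h]

theorem CompP.lt (hf : Comp Γ f) (hg : Comp Γ g) : CompP Γ (fun e v => f e v < g e v) :=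
  (CompP.ne_zero (hg.sub hf)).congr fun e v _ => by omega

theorem CompP.not (hp : CompP Γ p) : CompP Γ (fun e v => ¬ p e v) :=
  (CompP.lt hp (.const 1)).congr fun e v _ => by
    rw [Nat.lt_one_iff, ← not_iff_not, not_not]; exact ind_ne_zero

theorem CompP.and (hp : CompP Γ p) (hq : CompP Γ q) : CompP Γ (fun e v => p e v ∧ q e v) :=
  (CompP.ne_zero (Comp.ite hp hq (.const 0))).congr fun e v _ => by
    by_cases h : p e v
    · simp [h, ind_ne_zero]
    · simp [h, ind_of_not]

theorem CompP.imp (hp : CompP Γ p) (hq : CompP Γ q) : CompP Γ (fun e v => p e v → q e v) :=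
  (hp.and hq.not).not.congr fun e v _ => by tauto

theorem CompP.or (hp : CompP Γ p) (hq : CompP Γ q) : CompP Γ (fun e v => p e v ∨ q e v) :=
  (hp.not.imp hq).congr fun e v _ => by tauto

theorem CompP.iff (hp : CompP Γ p) (hq : CompP Γ q) : CompP Γ (fun e v => p e v ↔ q e v) :=
  ((hp.imp hq).and (hq.imp hp)).congr fun e v _ => by tauto

theorem CompP.eq (hf : Comp Γ f) (hg : Comp Γ g) : CompP Γ (fun e v => f e v = g e v) :=
  ((CompP.lt hf hg).not.and (CompP.lt hg hf).not).congr fun e v _ => by omega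

theorem CompP.le (hf : Comp Γ f) (hg : Comp Γ g) : CompP Γ (fun e v => f e v ≤ g e v) :=
  (CompP.lt hg hf).not.congr fun e v _ => by omega

/-- A value that is computable from a loop variable is computable if there is an accumulator as
well. -/
theorem Comp.skip {f : RamStore → V × ℕ → ℕ} (hf : Comp Γ.loop f) :
    Comp Γ.acc.loop (fun e x => f e (x.1.1, x.2)) := by
  rintro d rep ⟨d₁, r, l, ⟨d₂, r', l', h₁, h₂, h₃, rfl⟩, h₄, h₅, rfl⟩
  obtain ⟨p, C, hp⟩ := hf d _ ⟨d₂, r', l, h₁, by omega, h₅, rfl⟩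
  exact ⟨p, C, fun e x σ hi he hv => hp e (x.1.1, x.2) σ ⟨hi.1.1, hi.2⟩ he ⟨hv.1.1, hv.2⟩⟩

theorem iter_ite {A : Type} (a : A) (s : A → ℕ → A) {j m : ℕ} (h : j ≤ m) :
    iter a (fun x i => if ind (i < j) ≠ 0 then s x i else x) m = iter a s j := by
  induction m with
  | zero => obtain rfl : j = 0 := by omega
            rfl
  | succ m ih =>
    by_cases hj : j = m + 1
    · subst hj
      have : ∀ i ≤ m + 1, iter a (fun x i => if ind (i < m + 1) ≠ 0 then s x i else x) i =
          iter a s i := by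
        intro i
        induction i with
        | zero => exact fun _ => rfl
        | succ i ih' =>
          intro hi
          rw [iter, iter, ih' (by omega), if_pos (ind_ne_zero.2 (by omega))]
      exact this _ le_rfl
    · rw [iter, ih (by omega), if_neg]
      rw [ind_ne_zero]; omega

/-- Iteration with a computable number of rounds, which is at most the loop bound. -/
theorem Comp.iter_le {s : RamStore → V → ℕ → ℕ → ℕ} (hb : Comp Γ b)
    (hB : ∀ e v, Γ.inv e v → b e v ≤ e 4 0) (hf : Comp Γ f)
    (hs : Comp Γ.acc.loop (fun e x => s e x.1.1 x.1.2 x.2)) :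
    Comp Γ (fun e v => FallRam.iter (f e v) (s e v) (b e v)) :=
  (Comp.iter (s := fun e v x i => if ind (i < b e v) ≠ 0 then s e v x i else x) hf
    (Comp.cond (CompP.lt .var0 hb.weak.weak) hs Comp.var0.weak)).congr
    fun e v hi => iter_ite _ _ (hB e v hi)

theorem iter_add (f : ℕ → ℕ) (m : ℕ) :
    iter 0 (fun x i => x + f i) m = ∑ i ∈ Finset.range m, f i := by
  induction m with
  | zero => rfl
  | succ m ih => rw [Finset.sum_range_succ, ← ih]; rfl

theorem Comp.sum {f : RamStore → V → ℕ → ℕ} (hb : Comp Γ b)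
    (hB : ∀ e v, Γ.inv e v → b e v ≤ e 4 0) (hf : Comp Γ.loop (fun e x => f e x.1 x.2)) :
    Comp Γ (fun e v => ∑ i ∈ Finset.range (b e v), f e v i) :=
  (Comp.iter_le (s := fun e v x i => x + f e v i) hb hB (.const 0)
    (Comp.add Comp.var0.weak hf.skip)).congr fun _ _ _ => iter_add _ _

theorem CompP.all {p : RamStore → V → ℕ → Prop} (hb : Comp Γ b)
    (hB : ∀ e v, Γ.inv e v → b e v ≤ e 4 0) (hp : CompP Γ.loop (fun e x => p e x.1 x.2)) :
    CompP Γ (fun e v => ∀ i < b e v, p e v i) :=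
  (CompP.eq (Comp.sum (f := fun e v i => ind (¬ p e v i)) hb hB hp.not) (.const 0)).congr
    fun e v _ => by
      rw [Finset.sum_eq_zero_iff]
      refine forall_congr' fun i => imp_congr Finset.mem_range ?_
      rw [← not_iff_not]
      exact ind_ne_zero

theorem CompP.ex {p : RamStore → V → ℕ → Prop} (hb : Comp Γ b)
    (hB : ∀ e v, Γ.inv e v → b e v ≤ e 4 0) (hp : CompP Γ.loop (fun e x => p e x.1 x.2)) :
    CompP Γ (fun e v => ∃ i < b e v, p e v i) :=
  (CompP.all (p := fun e v i => ¬ p e v i) hb hB hp.not).not.congr fun e v _ => by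
    push Not; rfl

/-- A quantifier over a fixed number of indices is unfolded, so that the predicate need only be
computable for each index separately. -/
theorem CompP.all_const {p : RamStore → V → ℕ → Prop} (m : ℕ)
    (hp : ∀ i < m, CompP Γ (fun e v => p e v i)) : CompP Γ (fun e v => ∀ i < m, p e v i) := by
  induction m with
  | zero => exact (CompP.lt (.const 0) (.const 1)).congr fun e v _ => by simp
  | succ m ih =>
    refine ((ih fun i hi => hp i (by omega)).and (hp m (by omega))).congr fun e v _ => ?_
    rw [Nat.forall_lt_succ_right]

theorem CompP.ex_const {p : RamStore → V → ℕ → Prop} (m : ℕ)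
    (hp : ∀ i < m, CompP Γ (fun e v => p e v i)) : CompP Γ (fun e v => ∃ i < m, p e v i) :=
  (CompP.all_const (p := fun e v i => ¬ p e v i) m fun i hi => (hp i hi).not).not.congr
    fun e v _ => by push Not; rfl

theorem Comp.sum_const {f : RamStore → V → ℕ → ℕ} (m : ℕ)
    (hf : ∀ i < m, Comp Γ (fun e v => f e v i)) :
    Comp Γ (fun e v => ∑ i ∈ Finset.range m, f e v i) := by
  induction m with
  | zero => exact Comp.const 0
  | succ m ih =>
    simp only [Finset.sum_range_succ]
    exact (ih fun i hi => hf i (by omega)).add (hf m (by omega))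

theorem Comp.mul (hf : Comp Γ f) (hB : ∀ e v, Γ.inv e v → f e v ≤ e 4 0) (hg : Comp Γ g) :
    Comp Γ (fun e v => f e v * g e v) :=
  (Comp.sum (f := fun e v _ => g e v) hf hB hg.weak).congr fun e v _ => by simp

theorem iter_mul (a j : ℕ) : iter 1 (fun x _ => a * x) j = a ^ j := by
  induction j with
  | zero => rfl
  | succ j ih => rw [pow_succ', ← ih]; rfl

theorem Comp.pow (hf : Comp Γ f) (hB : ∀ e v, Γ.inv e v → f e v ≤ e 4 0) (hg : Comp Γ g)
    (hB' : ∀ e v, Γ.inv e v → g e v ≤ e 4 0) : Comp Γ (fun e v => f e v ^ g e v) :=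
  (Comp.iter_le (s := fun e v x _ => f e v * x) hg hB' (.const 1)
    (Comp.mul hf.weak.weak (fun e x h => hB e x.1.1 h.1.1) Comp.var0.weak)).congr
    fun _ _ _ => iter_mul _ _

theorem div_eq_sum {a b B : ℕ} (h : a ≤ B) (hb : 0 < b) :
    ∑ i ∈ Finset.range B, ind ((i + 1) * b ≤ a) = a / b := by
  have h₁ : a / b ≤ B := (Nat.div_le_self a b).trans h
  rw [← Finset.sum_subset (Finset.range_subset_range.2 h₁)]
  · rw [Finset.sum_congr rfl (g := fun _ => 1)]
    · simp
    · intro i hi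
      rw [Finset.mem_range, Nat.lt_iff_add_one_le, Nat.le_div_iff_mul_le hb] at hi
      exact ind_of hi
  · intro i _ hi
    rw [Finset.mem_range, Nat.lt_iff_add_one_le, Nat.le_div_iff_mul_le hb] at hi
    exact ind_of_not hi

theorem Comp.div (hf : Comp Γ f) (hB : ∀ e v, Γ.inv e v → f e v ≤ e 4 0) (hg : Comp Γ g)
    (hg' : ∀ e v, Γ.inv e v → 0 < g e v) : Comp Γ (fun e v => f e v / g e v) :=
  (Comp.sum (f := fun e v i => ind ((i + 1) * g e v ≤ f e v)) .bound (fun _ _ _ => le_rfl)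
    (CompP.le (Comp.mul (Comp.var0.add (.const 1)) (fun _ _ h => h.2) hg.weak) hf.weak)).congr
    fun e v hi => div_eq_sum (hB e v hi) (hg' e v hi)

theorem Comp.mod (hf : Comp Γ f) (hB : ∀ e v, Γ.inv e v → f e v ≤ e 4 0) (hg : Comp Γ g)
    (hg' : ∀ e v, Γ.inv e v → 0 < g e v) : Comp Γ (fun e v => f e v % g e v) :=
  (Comp.sub hf (Comp.mul (Comp.div hf hB hg hg')
    (fun e v hi => (Nat.div_le_self _ _).trans (hB e v hi)) hg)).congr
    fun e v _ => by rw [mul_comm, Nat.mod_eq_sub_mul_div]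

/-- The digits of a number below the loop bound. -/
theorem Comp.digit {c : RamStore → V → ℕ} (hb : Comp Γ b)
    (hbB : ∀ e v, Γ.inv e v → 0 < b e v ∧ b e v ≤ e 4 0)
    (hf : Comp Γ f) (hB : ∀ e v, Γ.inv e v → f e v ≤ e 4 0) (hc : Comp Γ c)
    (hcB : ∀ e v, Γ.inv e v → c e v ≤ e 4 0) :
    Comp Γ (fun e v => digit (b e v) (f e v) (c e v)) :=
  Comp.mod (Comp.div hf hB (Comp.pow hb (fun e v h => (hbB e v h).2) hc hcB)
    fun e v h => Nat.pow_pos (hbB e v h).1)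
    (fun e v h => (Nat.div_le_self _ _).trans (hB e v h)) hb fun e v h => (hbB e v h).1

end Logic

end FallRam

/-! ### Computability of the functions of an instance -/

namespace FallRam

theorem inst_update (e : RamStore) (F : ℕ → ℕ) : inst (Function.update e 5 F) = inst e := by
  simp [inst]

/-- The loop bound exceeds the numbers of vertices and of nodes. -/
def IsSmall (e : RamStore) : Prop := e 0 0 + e 0 2 + 1 ≤ e 4 0

/-- The cells `0` and `1` of array `6` contain the width `w` and the number `2 ^ (6 * w)` of triples
of types, and the loop bound exceeds all codes of multisets of such triples. -/
structure IsLarge (e : RamStore) : Prop where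
  bound : 8 * (e 0 0 + e 0 2 + 1) ≤ e 4 0
  width : e 6 0 = (inst e).width
  triples : e 6 1 = 2 ^ (6 * (inst e).width)
  codes : ((inst e).n + 1) ^ 2 ^ (6 * (inst e).width) ≤ e 4 0

variable {V : Type} {Γ : Ctx V}

/-- In the context `Γ`, the loop bound exceeds the numbers of vertices and of nodes. -/
class Ctx.Small (Γ : Ctx V) : Prop where
  small : ∀ e v, Γ.inv e v → IsSmall e

/-- In the context `Γ`, the loop bound and the auxiliary numbers have their final values. -/
class Ctx.Large (Γ : Ctx V) : Prop where
  large : ∀ e v, Γ.inv e v → IsLarge e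

instance [Γ.Small] (Q : RamStore → V → ℕ → Prop) (hQ) : (Γ.ext Q hQ).Small :=
  ⟨fun e v h => Ctx.Small.small e v.1 h.1⟩

instance [Γ.Large] (Q : RamStore → V → ℕ → Prop) (hQ) : (Γ.ext Q hQ).Large :=
  ⟨fun e v h => Ctx.Large.large e v.1 h.1⟩

instance [Γ.Large] : Γ.Small :=
  ⟨fun e v h => by have := (Ctx.Large.large e v h).bound; unfold IsSmall; omega⟩

theorem Ctx.n_lt [Γ.Small] (e : RamStore) (v : V) (h : Γ.inv e v) : (inst e).n < e 4 0 := by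
  have : e 0 0 + e 0 2 + 1 ≤ e 4 0 := Ctx.Small.small e v h
  change e 0 0 < _
  omega

theorem Ctx.n_le [Γ.Small] (e : RamStore) (v : V) (h : Γ.inv e v) : (inst e).n ≤ e 4 0 :=
  (Ctx.n_lt e v h).le

theorem Ctx.N_le [Γ.Small] (e : RamStore) (v : V) (h : Γ.inv e v) : (inst e).N ≤ e 4 0 := by
  have : e 0 0 + e 0 2 + 1 ≤ e 4 0 := Ctx.Small.small e v h
  change e 0 2 ≤ _
  omega

theorem Ctx.loop_le (e : RamStore) (x : V × ℕ) (h : Γ.loop.inv e x) : x.2 ≤ e 4 0 := le_of_lt h.2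

theorem Comp.inst_n : Comp Γ (fun e _ => (inst e).n) := Comp.read 0 (by omega) (.const 0)

theorem Comp.inst_k : Comp Γ (fun e _ => (inst e).k) := Comp.read 0 (by omega) (.const 1)

theorem Comp.inst_N : Comp Γ (fun e _ => (inst e).N) := Comp.read 0 (by omega) (.const 2)

theorem Comp.inst_root : Comp Γ (fun e _ => (inst e).root) := Comp.read 0 (by omega) (.const 3)

section Small

variable [Γ.Small] {p u w : RamStore → V → ℕ}

theorem CompP.adj (hu : Comp Γ u) (hw : Comp Γ w) :
    CompP Γ (fun e v => (inst e).adj (u e v) (w e v)) := by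
  refine ((CompP.lt hu Comp.inst_n).and (CompP.lt hw Comp.inst_n)).and
    (CompP.ne_zero (Comp.read 1 (by omega) (Comp.add ?_ hw)))
  exact (Comp.mul Comp.inst_n Ctx.n_le hu).congr fun e v _ => mul_comm _ _

theorem iter_par (g : ℕ → ℕ) (a i : ℕ) : iter a (fun x _ => g x) i = g^[i] a := by
  induction i with
  | zero => rfl
  | succ i ih => rw [Function.iterate_succ_apply', ← ih]; rfl

theorem CompP.mem (hp : Comp Γ p) (hu : Comp Γ u) :
    CompP Γ (fun e v => (inst e).Mem (p e v) (u e v)) := by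
  refine CompP.or (CompP.and (CompP.lt hp .inst_N) (CompP.ex .inst_N Ctx.N_le ?_))
    (CompP.and (CompP.not (CompP.lt hp .inst_N)) (CompP.eq hp (Comp.add .inst_N hu)))
  refine CompP.eq (Comp.congr (Comp.iter_le (s := fun e _ x _ => e 2 x) Comp.var0 Ctx.loop_le
    (Comp.read 3 (by omega) hu.weak) (Comp.read 2 (by omega) Comp.var0.weak)) ?_) hp.weak
  exact fun e v _ => iter_par _ _ _

theorem CompP.eqv (hp : Comp Γ p) (hu : Comp Γ u) (hw : Comp Γ w) :
    CompP Γ (fun e v => (inst e).Eqv (p e v) (u e v) (w e v)) :=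
  CompP.all .inst_n Ctx.n_le (CompP.imp (CompP.not (CompP.mem hp.weak .var0))
    (CompP.iff (CompP.adj hu.weak .var0) (CompP.adj hw.weak .var0)))

theorem CompP.noneBelow (hp : Comp Γ p) (hu : Comp Γ u)
    (hB : ∀ e v, Γ.inv e v → u e v ≤ e 4 0) (hw : Comp Γ w) :
    CompP Γ (fun e v => (inst e).NoneBelow (p e v) (u e v) (w e v)) :=
  CompP.all hu hB (CompP.imp (CompP.mem hp.weak .var0)
    (CompP.not (CompP.eqv hp.weak .var0 hw.weak)))

theorem CompP.isRep (hp : Comp Γ p) (hu : Comp Γ u)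
    (hB : ∀ e v, Γ.inv e v → u e v ≤ e 4 0) :
    CompP Γ (fun e v => (inst e).IsRep (p e v) (u e v)) :=
  CompP.and (CompP.mem hp hu) (CompP.noneBelow hp hu hB hu)

theorem Comp.cls (hp : Comp Γ p) (hu : Comp Γ u) :
    Comp Γ (fun e v => (inst e).cls (p e v) (u e v)) :=
  Comp.sum (f := fun e v i => ind ((inst e).IsRep (p e v) i ∧
      (inst e).NoneBelow (p e v) (i + 1) (u e v))) .inst_n Ctx.n_le
    (CompP.and (CompP.isRep hp.weak .var0 Ctx.loop_le)
      (CompP.noneBelow hp.weak (Comp.add .var0 (.const 1)) (fun _ _ h => h.2) hu.weak))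

theorem Comp.numCls (hp : Comp Γ p) : Comp Γ (fun e v => (inst e).numCls (p e v)) :=
  Comp.sum (f := fun e v i => ind ((inst e).IsRep (p e v) i)) .inst_n Ctx.n_le
    (CompP.isRep hp.weak .var0 Ctx.loop_le)

theorem iter_max (f : ℕ → ℕ) (m : ℕ) :
    iter 0 (fun x i => x + (f i - x)) m = (Finset.range m).sup f := by
  induction m with
  | zero => rfl
  | succ m ih =>
    rw [Finset.range_add_one, Finset.sup_insert, ← ih]
    change iter _ _ m + (f m - iter _ _ m) = max _ _
    omega

theorem Comp.width : Comp Γ (fun e _ => (inst e).width) :=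
  (Comp.iter_le (s := fun e _ x i => x + ((inst e).numCls i - x)) .inst_N Ctx.N_le (.const 0)
    (Comp.add Comp.var0.weak (Comp.sub (Comp.numCls .var0) Comp.var0.weak))).congr
    fun _ _ _ => iter_max _ _

end Small

section Large

variable [Γ.Large]

theorem Comp.width_cell : Comp Γ (fun e _ => (inst e).width) :=
  (Comp.read 6 (by omega) (.const 0)).congr fun e v h => (Ctx.Large.large e v h).width

theorem Comp.triples : Comp Γ (fun e _ => 2 ^ (6 * (inst e).width)) :=
  (Comp.read 6 (by omega) (.const 1)).congr fun e v h => (Ctx.Large.large e v h).triples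

theorem Ctx.mul_le (e : RamStore) (v : V) (h : Γ.inv e v) (m : ℕ) (hm : m ≤ 8) :
    m * ((inst e).n + 1) ≤ e 4 0 := by
  have h₁ := (Ctx.Large.large e v h).bound
  have h₂ : (inst e).n = e 0 0 := rfl
  have h₃ : m * ((inst e).n + 1) ≤ 8 * ((inst e).n + 1) := Nat.mul_le_mul_right _ hm
  omega

theorem Ctx.width_mul_le (e : RamStore) (v : V) (h : Γ.inv e v) (m : ℕ) (hm : m ≤ 8) :
    m * (inst e).width ≤ e 4 0 :=
  (Nat.mul_le_mul_left m (Inst.width_le.trans (Nat.le_succ _))).trans (Ctx.mul_le e v h m hm)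

theorem Ctx.pow_le (e : RamStore) (v : V) (h : Γ.inv e v) {a : ℕ} (ha : a ≤ 6 * (inst e).width) :
    ((inst e).n + 1) ^ 2 ^ a ≤ e 4 0 :=
  (Nat.pow_le_pow_right (by omega) (Nat.pow_le_pow_right (by omega) ha)).trans
    (Ctx.Large.large e v h).codes

/-- The number of types is below the loop bound, because there are codes for all multisets of
types. -/
theorem Ctx.two_pow_le (e : RamStore) (v : V) (h : Γ.inv e v) {a : ℕ}
    (ha : a ≤ 6 * (inst e).width) : 2 ^ a ≤ e 4 0 := by
  by_cases hn : (inst e).n = 0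
  · have h₁ : (inst e).width = 0 := Nat.le_zero.1 (hn ▸ Inst.width_le)
    have h₂ := Ctx.mul_le e v h 1 (by omega)
    obtain rfl : a = 0 := by omega
    rw [pow_zero]
    omega
  · exact (Nat.lt_pow_self (by omega)).le.trans (Ctx.pow_le e v h ha)

theorem CompP.bit {f c : RamStore → V → ℕ} (hf : Comp Γ f)
    (hB : ∀ e v, Γ.inv e v → f e v ≤ e 4 0) (hc : Comp Γ c)
    (hcB : ∀ e v, Γ.inv e v → c e v ≤ e 4 0) : CompP Γ (fun e v => Bit (f e v) (c e v)) :=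
  CompP.eq (Comp.digit (.const 2) (fun e v h => by
    have := Ctx.mul_le e v h 2 (by omega)
    omega) hf hB hc hcB) (.const 1)

variable {p₀ p₁ p₂ t x u : RamStore → V → ℕ} {P : RamStore → V → ℕ → ℕ}

theorem Comp.prj (hx : Comp Γ x) (hB : ∀ e v, Γ.inv e v → x e v ≤ e 4 0) {j : ℕ} (hj : j < 3) :
    Comp Γ (fun e v => (inst e).prj j (x e v)) := by
  have h2 : ∀ (e : RamStore) (v : V), Γ.inv e v → 2 ≤ e 4 0 := fun e v h => by
    have := Ctx.mul_le e v h 2 (by omega)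
    omega
  have hw : Comp Γ (fun e _ => 2 * (inst e).width) :=
    (Comp.add .width_cell .width_cell).congr fun e v _ => (two_mul _).symm
  have hwj : Comp Γ (fun e _ => 2 * (inst e).width * j) :=
    (Comp.sum_const j fun i _ => hw).congr fun e v _ => by simp [mul_comm]
  refine Comp.mod (Comp.div hx hB (Comp.pow (.const 2) h2 hwj fun e v h => ?_)
    fun _ _ _ => by positivity) (fun e v h => (Nat.div_le_self _ _).trans (hB e v h))
    (Comp.pow (.const 2) h2 hw fun e v h => Ctx.width_mul_le e v h 2 (by omega))
    fun _ _ _ => by positivity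
  refine le_trans ?_ (Ctx.width_mul_le e v h 4 (by omega))
  have : j = 0 ∨ j = 1 ∨ j = 2 := by omega
  rcases this with rfl | rfl | rfl <;> omega

theorem Ctx.prj_le (e : RamStore) (v : V) (h : Γ.inv e v) (j x : ℕ) :
    (inst e).prj j x ≤ e 4 0 :=
  (Inst.prj_lt j x).le.trans (Ctx.two_pow_le e v h (by omega))

theorem CompP.sel (hx : Comp Γ x) (hB : ∀ e v, Γ.inv e v → x e v ≤ e 4 0) {j : ℕ} (hj : j < 3)
    (hP : Comp Γ (fun e v => P e v j)) (hu : Comp Γ u) :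
    CompP Γ (fun e v => (inst e).Sel (P e v) j (x e v) (u e v)) :=
  CompP.bit (Comp.prj hx hB hj) (fun e v h => Ctx.prj_le e v h _ _) (Comp.cls hP hu)
    fun e v h => (Inst.cls_le _ _).trans (Ctx.n_le e v h)

theorem CompP.und (hx : Comp Γ x) (hB : ∀ e v, Γ.inv e v → x e v ≤ e 4 0) {j : ℕ} (hj : j < 3)
    (hP : Comp Γ (fun e v => P e v j)) (hu : Comp Γ u) :
    CompP Γ (fun e v => (inst e).Und (P e v) j (x e v) (u e v)) :=
  CompP.bit (Comp.prj hx hB hj) (fun e v h => Ctx.prj_le e v h _ _)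
    (Comp.add .width_cell (Comp.cls hP hu)) fun e v h => by
      have h₁ := Ctx.mul_le e v h 2 (by omega)
      have h₂ : (inst e).cls (P e v j) (u e v) ≤ (inst e).n := Inst.cls_le _ _
      have h₃ : (inst e).width ≤ (inst e).n := Inst.width_le
      omega

theorem CompP.away (hx : Comp Γ x) (hB : ∀ e v, Γ.inv e v → x e v ≤ e 4 0) (j : ℕ)
    (hP : ∀ j < 3, Comp Γ (fun e v => P e v j)) (hu : Comp Γ u) :
    CompP Γ (fun e v => (inst e).Away (P e v) j (x e v) (u e v)) := by
  refine CompP.all_const 3 fun i hi => CompP.imp (CompP.not (CompP.eq (.const i) (.const j)))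
    (CompP.all .inst_n Ctx.n_le (CompP.imp (CompP.mem (hP i hi).weak .var0) (CompP.imp ?_
      (CompP.not (CompP.adj .var0 hu.weak)))))
  exact CompP.sel (Γ := Γ.loop) (P := fun e x => P e x.1) hx.weak (fun e v h => hB e v.1 h.1)
    hi (hP i hi).weak .var0

theorem CompP.allowed (hx : Comp Γ x) (hB : ∀ e v, Γ.inv e v → x e v ≤ e 4 0)
    (hP : ∀ j < 3, Comp Γ (fun e v => P e v j)) :
    CompP Γ (fun e v => (inst e).Allowed (P e v) (x e v)) := by
  refine CompP.all_const 3 fun j hj => CompP.all .inst_n Ctx.n_le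
    (CompP.imp (CompP.mem (hP j hj).weak .var0) (CompP.imp ?_ ?_))
  · exact CompP.sel (Γ := Γ.loop) (P := fun e x => P e x.1) hx.weak (fun e v h => hB e v.1 h.1) hj
      (hP j hj).weak .var0
  · exact CompP.away (Γ := Γ.loop) (P := fun e x => P e x.1) hx.weak (fun e v h => hB e v.1 h.1) j
      (fun i hi => (hP i hi).weak) .var0

theorem Comp.res (ht : Comp Γ t) (hx : Comp Γ x) (hB : ∀ e v, Γ.inv e v → x e v ≤ e 4 0)
    (hP : ∀ j < 3, Comp Γ (fun e v => P e v j)) :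
    Comp Γ (fun e v => (inst e).res (t e v) (P e v) (x e v)) := by
  have hw : Comp Γ (fun e _ => 2 * (inst e).width) :=
    (Comp.add .width_cell .width_cell).congr fun e v _ => (two_mul _).symm
  have h₁ : ∀ (e : RamStore) (v : V), Γ.inv e v → 2 ≤ e 4 0 := fun e v h => by
    have := Ctx.mul_le e v h 2 (by omega)
    omega
  refine Comp.sum hw (fun e v h => Ctx.width_mul_le e v h 2 (by omega))
    (Comp.mul ?_ (fun e x h => (Nat.lt_succ_iff.1 (ind_lt_two _)).trans
      (le_of_lt (h₁ e x.1 h.1))) (Comp.pow (.const 2) (fun e x h => h₁ e x.1 h.1) .var0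
        Ctx.loop_le))
  refine CompP.ex .inst_n Ctx.n_le (CompP.ex_const 3 fun j hj => CompP.and
    (CompP.mem (hP j hj).weak.weak .var0) (CompP.or (CompP.and
      (CompP.eq Comp.var0.weak (Comp.cls ht.weak.weak .var0)) ?_) (CompP.and
      (CompP.eq Comp.var0.weak (Comp.add .width_cell (Comp.cls ht.weak.weak .var0)))
      (CompP.and ?_ ?_))))
  · exact CompP.sel (Γ := Γ.loop.loop) (P := fun e x => P e x.1.1) hx.weak.weak
      (fun e v h => hB e v.1.1 h.1.1) hj
      (hP j hj).weak.weak .var0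
  · exact CompP.und (Γ := Γ.loop.loop) (P := fun e x => P e x.1.1) hx.weak.weak
      (fun e v h => hB e v.1.1 h.1.1) hj
      (hP j hj).weak.weak .var0
  · exact CompP.away (Γ := Γ.loop.loop) (P := fun e x => P e x.1.1) hx.weak.weak
      (fun e v h => hB e v.1.1 h.1.1) j
      (fun i hi => (hP i hi).weak.weak) .var0

theorem Ctx.triples_le (e : RamStore) (v : V) (h : Γ.inv e v) :
    2 ^ (6 * (inst e).width) ≤ e 4 0 := Ctx.two_pow_le e v h le_rfl

theorem Ctx.base_le (e : RamStore) (v : V) (h : Γ.inv e v) :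
    0 < (inst e).n + 1 ∧ (inst e).n + 1 ≤ e 4 0 := ⟨by omega, Ctx.n_lt e v h⟩

variable {M : RamStore → V → ℕ}

theorem Comp.digit_base (hM : Comp Γ M) (hB : ∀ e v, Γ.inv e v → M e v ≤ e 4 0) :
    Comp Γ.loop (fun e x => FallRam.digit ((inst e).n + 1) (M e x.1) x.2) :=
  Comp.digit (Comp.add .inst_n (.const 1)) Ctx.base_le hM.weak (fun e x h => hB e x.1 h.1) .var0
    Ctx.loop_le

theorem Comp.sum_digit (hM : Comp Γ M) (hB : ∀ e v, Γ.inv e v → M e v ≤ e 4 0) :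
    Comp Γ (fun e v => ∑ x ∈ Finset.range (2 ^ (6 * (inst e).width)),
      FallRam.digit ((inst e).n + 1) (M e v) x) :=
  Comp.sum .triples Ctx.triples_le (Comp.digit_base hM hB)

theorem Comp.sum_digit_mul_pow {g : RamStore → V → ℕ → ℕ} (hM : Comp Γ M)
    (hB : ∀ e v, Γ.inv e v → M e v ≤ e 4 0) (hg : Comp Γ.loop (fun e x => g e x.1 x.2))
    (hgB : ∀ e v x, g e v x < 2 ^ (2 * (inst e).width)) :
    Comp Γ (fun e v => ∑ x ∈ Finset.range (2 ^ (6 * (inst e).width)),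
      FallRam.digit ((inst e).n + 1) (M e v) x * ((inst e).n + 1) ^ g e v x) :=
  Comp.sum .triples Ctx.triples_le (Comp.mul (Comp.digit_base hM hB)
    (fun e x h => (Nat.mod_lt _ (Nat.succ_pos _)).le.trans (Ctx.base_le e x.1 h.1).2)
    (Comp.pow (Comp.add .inst_n (.const 1)) (fun e x h => (Ctx.base_le e x h).2) hg
      fun e x h => (hgB e x.1 x.2).le.trans (Ctx.two_pow_le e x h (by omega))))

theorem Comp.marginal (hM : Comp Γ M) (hB : ∀ e v, Γ.inv e v → M e v ≤ e 4 0) {j : ℕ}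
    (hj : j < 3) : Comp Γ (fun e v => (inst e).marginal j (M e v)) :=
  Comp.sum_digit_mul_pow (g := fun e _ x => (inst e).prj j x) hM hB
    (Comp.prj .var0 Ctx.loop_le hj) fun _ _ _ => Inst.prj_lt _ _

theorem Comp.merged (ht : Comp Γ t) (hP : ∀ j < 3, Comp Γ (fun e v => P e v j)) (hM : Comp Γ M)
    (hB : ∀ e v, Γ.inv e v → M e v ≤ e 4 0) :
    Comp Γ (fun e v => (inst e).merged (t e v) (P e v) (M e v)) :=
  Comp.sum_digit_mul_pow (g := fun e v x => (inst e).res (t e v) (P e v) x) hM hB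
    (Comp.res (Γ := Γ.loop) (P := fun e x => P e x.1) ht.weak .var0 Ctx.loop_le
      fun j hj => (hP j hj).weak)
    fun _ _ _ => Inst.res_lt _ _ _

theorem Comp.pow_two_pow_width : Comp Γ (fun e _ => ((inst e).n + 1) ^ 2 ^ (inst e).width) :=
  Comp.pow (Comp.add .inst_n (.const 1)) (fun e v h => (Ctx.base_le e v h).2)
    (Comp.pow (.const 2) (fun e v h => by
      have := Ctx.mul_le e v h 2 (by omega)
      omega) .width_cell fun e v h => by
        have := Ctx.width_mul_le e v h 1 (by omega)
        omega)
    fun e v h => Ctx.two_pow_le e v h (by omega)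

theorem CompP.fact {p s : RamStore → V → ℕ} (hp : Comp Γ p) (hs : Comp Γ s) :
    CompP Γ (fun e v => (inst e).Fact (e 4 0) (e 5) (p e v) (s e v)) := by
  refine CompP.or (CompP.and (CompP.lt hp .inst_N) (CompP.ne_zero (Comp.read 5 (by omega)
    (Comp.add ?_ hs)))) (CompP.or (CompP.and (CompP.not (CompP.lt hp .inst_N)) (CompP.and
      (CompP.lt hp (Comp.add .inst_N .inst_n)) (CompP.eq hs (Comp.add
        (Comp.add .inst_n (.const 1)) ?_)))) (CompP.and
      (CompP.not (CompP.lt hp (Comp.add .inst_N .inst_n))) (CompP.eq hs .inst_k)))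
  · exact (Comp.mul .bound (fun _ _ _ => le_rfl) hp).congr fun _ _ _ => mul_comm _ _
  · exact (Comp.mul Comp.pow_two_pow_width (fun e v h => Ctx.pow_le e v h (by omega))
      (Comp.sub .inst_k (.const 1))).congr fun _ _ _ => mul_comm _ _

theorem CompP.splits (ht : Comp Γ t) (hP : ∀ j < 3, Comp Γ (fun e v => P e v j)) :
    CompP Γ (fun e v => (inst e).Splits (t e v) (P e v)) :=
  CompP.all .inst_n Ctx.n_le (CompP.eq (CompP.mem ht.weak .var0)
    (Comp.sum_const 3 fun j hj => CompP.mem (hP j hj).weak .var0))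

theorem CompP.guard (ht : Comp Γ t) (hP : ∀ j < 3, Comp Γ (fun e v => P e v j)) (hM : Comp Γ M)
    (hB : ∀ e v, Γ.inv e v → M e v ≤ e 4 0) :
    CompP Γ (fun e v => (inst e).Guard (e 4 0) (e 5) (t e v) (P e v) (M e v)) := by
  refine CompP.and (CompP.lt ht .inst_N) (CompP.and (CompP.splits ht hP) (CompP.and
    (CompP.eq (Comp.sum_digit hM hB) .inst_k) (CompP.and ?_ ?_)))
  · exact CompP.all .triples Ctx.triples_le (CompP.imp (CompP.ne_zero (Comp.digit_base hM hB))
      (CompP.allowed (Γ := Γ.loop) (P := fun e x => P e x.1) .var0 Ctx.loop_le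
        fun j hj => (hP j hj).weak))
  · exact CompP.all_const 3 fun j hj => CompP.fact (hP j hj) (Comp.marginal hM hB hj)

omit [Γ.Large] in
theorem Comp.parts (h₀ : Comp Γ p₀) (h₁ : Comp Γ p₁) (h₂ : Comp Γ p₂) (j : ℕ) :
    Comp Γ (fun e v => Inst.parts (p₀ e v) (p₁ e v) (p₂ e v) j) := by
  unfold Inst.parts
  split_ifs
  exacts [h₀, h₁, h₂]

theorem Act.markStep (ht : Comp Γ t) (hP : ∀ j < 3, Comp Γ (fun e v => P e v j))
    (hM : Comp Γ M) (hB : ∀ e v, Γ.inv e v → M e v ≤ e 4 0) :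
    Act Γ (fun e v => (inst e).mark (e 4 0) (e 5) (t e v) (P e v) (M e v)) :=
  Act.mark (CompP.guard ht hP hM hB)
    (Comp.add ((Comp.mul .bound (fun _ _ _ => le_rfl) ht).congr fun _ _ _ => mul_comm _ _)
      (Comp.merged ht hP hM hB))

omit [Γ.Large] in
theorem Act.loop_inst {g : Inst → ℕ → (ℕ → ℕ) → V → ℕ → (ℕ → ℕ)}
    (hg : Act Γ.loop (fun e x => g (inst e) (e 4 0) (e 5) x.1 x.2)) :
    Act Γ (fun e v => FallRam.iter (e 5) (fun F i => g (inst e) (e 4 0) F v i) (e 4 0)) := by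
  have := Act.loop (g := fun e v i => g (inst e) (e 4 0) (e 5) v i) hg
  simpa only [inst_update, Function.update_self, Function.update_of_ne (show 4 ≠ 5 by omega)]
    using this

theorem Act.round : Act Γ (fun e _ => (inst e).round (e 4 0) (e 5)) := by
  refine Act.loop_inst (g := fun X B F _ t => FallRam.iter F (fun F p₀ => FallRam.iter F
    (fun F p₁ => FallRam.iter F (fun F p₂ => FallRam.iter F (fun F M =>
      X.mark B F t (Inst.parts p₀ p₁ p₂) M) B) B) B) B) ?_
  refine Act.loop_inst (V := V × ℕ) (g := fun X B F y p₀ => FallRam.iter F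
    (fun F p₁ => FallRam.iter F (fun F p₂ => FallRam.iter F (fun F M =>
      X.mark B F y.2 (Inst.parts p₀ p₁ p₂) M) B) B) B) ?_
  refine Act.loop_inst (V := (V × ℕ) × ℕ) (g := fun X B F y p₁ => FallRam.iter F
    (fun F p₂ => FallRam.iter F (fun F M =>
      X.mark B F y.1.2 (Inst.parts y.2 p₁ p₂) M) B) B) ?_
  refine Act.loop_inst (V := ((V × ℕ) × ℕ) × ℕ) (g := fun X B F y p₂ => FallRam.iter F (fun F M =>
      X.mark B F y.1.1.2 (Inst.parts y.1.2 y.2 p₂) M) B) ?_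
  refine Act.loop_inst (V := (((V × ℕ) × ℕ) × ℕ) × ℕ) (g := fun X B F y M =>
      X.mark B F y.1.1.1.2 (Inst.parts y.1.1.2 y.1.2 y.2) M) ?_
  exact Act.markStep (P := fun _ (y : ((((V × ℕ) × ℕ) × ℕ) × ℕ) × ℕ) =>
      Inst.parts y.1.1.1.2 y.1.1.2 y.1.2)
    Comp.var0.weak.weak.weak.weak (fun j _ => Comp.parts Comp.var0.weak.weak.weak
      Comp.var0.weak.weak Comp.var0.weak j) .var0 Ctx.loop_le

theorem Act.table :
    Act Γ (fun e _ => FallRam.iter (e 5) (fun F _ => (inst e).round (e 4 0) F) (e 4 0)) :=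
  Act.loop_inst (g := fun X B F _ _ => X.round B F) Act.round

/-- The answer: whether some recorded coloring of the whole graph has only small types. -/
theorem CompP.answer : CompP Γ (fun e _ => (0 < (inst e).k ∧ (inst e).k ≤ (inst e).n) ∧
    ∃ s < e 4 0, s < ((inst e).n + 1) ^ 2 ^ (inst e).width ∧
      e 5 ((inst e).root * e 4 0 + s) ≠ 0) :=
  CompP.and (CompP.and (CompP.lt (.const 0) .inst_k) (CompP.le .inst_k .inst_n))
    (CompP.ex .bound (fun _ _ _ => le_rfl) (CompP.and (CompP.lt .var0 Comp.pow_two_pow_width)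
      (CompP.ne_zero (Comp.read 5 (by omega) (Comp.add
        ((Comp.mul .bound (fun _ _ _ => le_rfl) .inst_root).congr fun _ _ _ => mul_comm _ _)
        .var0)))))

end Large

end FallRam

/-! ### The program -/

namespace FallRam

/-- There is a program that changes data `e` satisfying `I` to the data `T e`, in time polynomial
in the final value of the loop bound, which never decreases. -/
def Stage (I : RamStore → Prop) (T : RamStore → RamStore) : Prop :=
  ∃ (p : RamProg) (C : ℕ), ∀ e σ, I e → Presents e σ → e 4 0 ≤ T e 4 0 ∧
    ∃ σ' t, p.Runs σ σ' t ∧ t ≤ C * (T e 4 0 + 1) ^ C ∧ Presents (T e) σ'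

theorem Stage.seq {I I' : RamStore → Prop} {T T' : RamStore → RamStore} (h : Stage I T)
    (h' : Stage I' T') (hI : ∀ e, I e → I' (T e)) : Stage I (fun e => T' (T e)) := by
  obtain ⟨p, C, hp⟩ := h
  obtain ⟨q, C', hq⟩ := h'
  refine ⟨.seq p q, C + C', fun e σ hi he => ?_⟩
  obtain ⟨a₁, σ₁, t₁, a₂, a₃, a₄⟩ := hp e σ hi he
  obtain ⟨b₁, σ₂, t₂, b₂, b₃, b₄⟩ := hq _ σ₁ (hI e hi) a₄
  refine ⟨a₁.trans b₁, σ₂, _, .seq a₂ b₂, poly_add (a₃.trans ?_) b₃, b₄⟩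
  exact Nat.mul_le_mul_left _ (Nat.pow_le_pow_left (Nat.succ_le_succ b₁) _)

theorem Stage.store {I : RamStore → Prop} {hI} {f : RamStore → ℕ}
    (hf : Comp (Ctx.base I hI) (fun e _ => f e)) (a i : ℕ) (ha : a = 4 → i = 0)
    (hm : ∀ e, e 4 0 ≤ put e a i (f e) 4 0) : Stage I (fun e => put e a i (f e)) := by
  obtain ⟨p, C, hp⟩ := hf.store a i ha
  refine ⟨p, C, fun e σ hi he => ⟨hm e, ?_⟩⟩
  obtain ⟨σ', t, h₁, h₂, h₃⟩ := hp e σ hi he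
  exact ⟨σ', t, h₁, h₂.trans (Nat.mul_le_mul_left _ (Nat.pow_le_pow_left
    (Nat.succ_le_succ (hm e)) _)), h₃⟩

theorem put_self (e : RamStore) (a i x : ℕ) : put e a i x a i = x := by
  simp [put]

theorem put_of_ne (e : RamStore) {a b i j : ℕ} (x : ℕ) (h : b ≠ a ∨ j ≠ i) :
    put e a i x b j = e b j := by
  unfold put
  by_cases hb : b = a
  · subst hb
    rw [Function.update_self, Function.update_of_ne (by tauto)]
  · rw [Function.update_of_ne hb]

theorem put_array_of_ne (e : RamStore) {a b i : ℕ} (x : ℕ) (h : b ≠ a) : put e a i x b = e b := by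
  rw [put, Function.update_of_ne h]

theorem inst_put (e : RamStore) {a i : ℕ} (x : ℕ) (ha : 4 ≤ a) : inst (put e a i x) = inst e := by
  have h : ∀ b < 4, put e a i x b = e b := fun b hb => put_array_of_ne e x (by omega)
  simp [inst, h]

/-- The first loop bound. -/
def initialBound (e : RamStore) : ℕ := 8 * (e 0 0 + e 0 2 + 1)

theorem Comp.initialBound {V : Type} {Γ : Ctx V} : Comp Γ (fun e _ => initialBound e) :=
  (Comp.sum_const 8 fun _ _ => Comp.add (Comp.add .inst_n .inst_N) (.const 1)).congr
    fun e v _ => by simp [FallRam.initialBound, inst]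

/-- A context in which the first loop bound is available. -/
theorem Ctx.small_of_initialBound {I : RamStore → Prop} {hI}
    (h : ∀ e, I e → initialBound e ≤ e 4 0) : (Ctx.base I hI).Small :=
  ⟨fun e _ hi => by have := h e hi; unfold initialBound at this; unfold IsSmall; omega⟩

theorem stage_width : Stage (fun e => initialBound e ≤ e 4 0)
    (fun e => put e 6 0 (inst e).width) := by
  have hI : ∀ (e : RamStore) F, initialBound e ≤ e 4 0 →
    initialBound (Function.update e 5 F) ≤ Function.update e 5 F 4 0 := fun e F h => by
      simpa [initialBound] using h
  have := Ctx.small_of_initialBound (hI := hI) fun e h => h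
  exact Stage.store (hI := hI) Comp.width 6 0 (by omega) fun e => by simp [put]

theorem stage_triples : Stage (fun e => initialBound e ≤ e 4 0)
    (fun e => put e 6 1 (2 ^ (6 * (inst e).width))) := by
  have hI : ∀ (e : RamStore) F, initialBound e ≤ e 4 0 →
    initialBound (Function.update e 5 F) ≤ Function.update e 5 F 4 0 := fun e F h => by
      simpa [initialBound] using h
  have := Ctx.small_of_initialBound (hI := hI) fun e h => h
  have hc : Comp (Ctx.base _ hI) (fun e _ => 2 ^ (6 * (inst e).width)) := by
    refine Comp.pow (.const 2) (fun e _ h => ?_)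
      ((Comp.sum_const 6 fun _ _ => Comp.width).congr fun e v _ => ?_) fun e _ h => ?_
    · have h' : 8 * (e 0 0 + e 0 2 + 1) ≤ e 4 0 := h
      omega
    · simp
    · have h' : 8 * ((inst e).n + e 0 2 + 1) ≤ e 4 0 := h
      have : (inst e).width ≤ (inst e).n := Inst.width_le
      omega
  exact Stage.store (f := fun e => 2 ^ (6 * (inst e).width)) hc 6 1 (by omega)
    fun e => by simp [put]

theorem stage_codes : Stage (fun e => initialBound e ≤ e 4 0 ∧ e 6 1 ≤ e 4 0)
    (fun e => put e 6 2 ((e 0 0 + 1) ^ e 6 1)) := by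
  have hI : ∀ (e : RamStore) F, initialBound e ≤ e 4 0 ∧ e 6 1 ≤ e 4 0 →
    initialBound (Function.update e 5 F) ≤ Function.update e 5 F 4 0 ∧
      Function.update e 5 F 6 1 ≤ Function.update e 5 F 4 0 := fun e F h => by
        simpa [initialBound] using h
  have := Ctx.small_of_initialBound (hI := hI) fun e h => h.1
  have hc : Comp (Ctx.base _ hI) (fun e _ => ((inst e).n + 1) ^ e 6 1) :=
    Comp.pow (Comp.add .inst_n (.const 1)) (fun e v h => Ctx.n_lt e v h)
      (Comp.read 6 (by omega) (.const 1)) fun e _ h => h.2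
  exact Stage.store (f := fun e => (e 0 0 + 1) ^ e 6 1) hc 6 2 (by omega) fun e => by simp [put]

/-- The loop bound is increased by a computable number. -/
theorem stage_bound {f : RamStore → ℕ} (hf : ∀ {V : Type} {Γ : Ctx V}, Comp Γ fun e _ => f e) :
    Stage (fun _ => True) (fun e => put e 4 0 (e 4 0 + f e)) :=
  Stage.store (hI := fun _ _ h => h) (f := fun e => e 4 0 + f e) (Comp.add .bound hf) 4 0
    (fun _ => rfl) fun _ => (Nat.le_add_right _ _).trans_eq (put_self _ _ _ _).symm

theorem isLarge_table (e : RamStore) (F : ℕ → ℕ) (h : IsLarge e) :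
    IsLarge (Function.update e 5 F) :=
  ⟨by simpa using h.bound, by simpa [inst_update] using h.width,
    by simpa [inst_update] using h.triples, by simpa [inst_update] using h.codes⟩

instance : (Ctx.base IsLarge isLarge_table).Large := ⟨fun _ _ h => h⟩

theorem stage_table : Stage IsLarge (fun e => Function.update e 5
    (iter (e 5) (fun F _ => (inst e).round (e 4 0) F) (e 4 0))) := by
  obtain ⟨p, C, hp⟩ := Act.table (Γ := Ctx.base IsLarge isLarge_table) 1 _ ⟨one_pos, rfl⟩
  refine ⟨p, C, fun e σ hi he => ⟨by simp, ?_⟩⟩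
  obtain ⟨σ', t, h₁, h₂, h₃, -⟩ := hp e () σ hi he trivial
  exact ⟨σ', t, h₁, by simpa using h₂, h₃⟩

/-- The criterion for the existence of a fall coloring, in terms of the final table. -/
def Answer (e : RamStore) : Prop := (0 < (inst e).k ∧ (inst e).k ≤ (inst e).n) ∧
  ∃ s < e 4 0, s < ((inst e).n + 1) ^ 2 ^ (inst e).width ∧ e 5 ((inst e).root * e 4 0 + s) ≠ 0

theorem stage_answer : Stage IsLarge (fun e => put e 0 0 (ind (Answer e))) :=
  Stage.store (hI := isLarge_table) CompP.answer 0 0 (by omega) fun e => by simp [put]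

/-- The memory before the table is computed, when the loop bound and the auxiliary numbers have
their final values. -/
noncomputable def prepare (e : RamStore) : RamStore :=
  let e := put e 4 0 (e 4 0 + initialBound e)
  let e := put e 6 0 (inst e).width
  let e := put e 6 1 (2 ^ (6 * (inst e).width))
  let e := put e 4 0 (e 4 0 + e 6 1)
  let e := put e 6 2 ((e 0 0 + 1) ^ e 6 1)
  put e 4 0 (e 4 0 + e 6 2)

theorem inst_prepare (e : RamStore) : inst (prepare e) = inst e := by
  simp [prepare, inst_put]

theorem prepare_table (e : RamStore) : prepare e 5 = e 5 := by
  simp [prepare, put_array_of_ne]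

theorem prepare_bound (e : RamStore) : prepare e 4 0 = e 4 0 + initialBound e +
    2 ^ (6 * (inst e).width) + ((inst e).n + 1) ^ 2 ^ (6 * (inst e).width) := by
  simp [prepare, put_self, put_of_ne, inst_put]
  rfl

theorem prepare_width (e : RamStore) : prepare e 6 0 = (inst e).width := by
  simp [prepare, put_self, put_of_ne, inst_put]

theorem prepare_triples (e : RamStore) : prepare e 6 1 = 2 ^ (6 * (inst e).width) := by
  simp [prepare, put_self, put_of_ne, inst_put]

theorem isLarge_prepare (e : RamStore) : IsLarge (prepare e) where
  bound := by
    have h : ∀ i, prepare e 0 i = e 0 i := fun i => by simp [prepare, put_array_of_ne]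
    rw [prepare_bound, h, h]
    exact (Nat.le_add_left (initialBound e) _).trans
      ((Nat.le_add_right _ _).trans (Nat.le_add_right _ _))
  width := by rw [inst_prepare, prepare_width]
  triples := by rw [inst_prepare, prepare_triples]
  codes := by rw [inst_prepare, prepare_bound]; exact Nat.le_add_left _ _

theorem stage_prepare : Stage (fun _ => True) prepare := by
  have h := (((((stage_bound Comp.initialBound).seq stage_width ?_).seq stage_triples ?_).seq
    (stage_bound (Comp.read 6 (by omega) (.const 1))) ?_).seq stage_codes ?_).seq
    (stage_bound (Comp.read 6 (by omega) (.const 2))) ?_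
  · exact h
  all_goals
    intro e _
    simp [put_self, put_of_ne, initialBound]
  exact (Nat.le_add_left _ _).trans (Nat.le_add_right _ _)

/-- The final memory. -/
noncomputable def final (e : RamStore) : RamStore :=
  let e := prepare e
  let e := Function.update e 5 (iter (e 5) (fun F _ => (inst e).round (e 4 0) F) (e 4 0))
  put e 0 0 (ind (Answer e))

theorem stage_final : Stage (fun _ => True) final :=
  (stage_prepare.seq stage_table fun e _ => isLarge_prepare e).seq stage_answer fun e _ =>
    isLarge_table _ _ (isLarge_prepare e)

theorem final_bound (e : RamStore) : final e 4 0 = prepare e 4 0 := by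
  simp [final, put_of_ne]

section Input

variable {n N : ℕ} (G : SimpleGraph (Fin n)) (D : RootedBranchDecomposition (Fin n) (Fin N))
  (k : ℕ)

theorem fallColInput_bound : prepare (fallColInput G D k) 4 0 = 8 * (n + N + 1) +
    2 ^ (6 * (input G D k).width) + (n + 1) ^ 2 ^ (6 * (input G D k).width) := by
  rw [prepare_bound]
  have h₁ : fallColInput G D k 4 0 = 0 := rfl
  have h₂ : initialBound (fallColInput G D k) = 8 * (n + N + 1) := rfl
  rw [h₁, h₂, zero_add]
  rfl

theorem final_fallColInput :
    final (fallColInput G D k) 0 0 = ind (HasFallColoring G k) := by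
  have hb := fallColInput_bound G D k
  have htab : fallColInput G D k 5 = fun _ => 0 := rfl
  have hi : inst (fallColInput G D k) = input G D k := rfl
  simp only [final, put_self, Answer, inst_update, inst_prepare, Function.update_self,
    Function.update_of_ne (show 4 ≠ 5 by omega), prepare_table, htab, hi]
  refine congrArg ind (propext ?_)
  refine (hasFallColoring_iff_table G D k ?_ ?_).symm
  · rw [hb]
    exact Nat.le_add_left _ _
  · rw [hb, add_assoc]
    exact (by omega : N + n < 8 * (n + N + 1)).trans_le (Nat.le_add_right _ _)

/-- A polynomial in the final loop bound is at most `c * N ^ c * n ^ 2 ^ (c * W)`, where `W ≥ w`: the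
factor `2 * C` in the exponent of `n` is absorbed by `c`, because `w` is positive. -/
theorem exists_time_le (C : ℕ) : ∃ c, ∀ n N w W : ℕ, 0 < n → 0 < N → 0 < w → w ≤ n → w ≤ W →
    C * (8 * (n + N + 1) + 2 ^ (6 * w) + (n + 1) ^ 2 ^ (6 * w) + 1) ^ C ≤
      c * N ^ c * n ^ 2 ^ (c * W) := by
  obtain ⟨c₀, hc₀⟩ : ∃ c₀, c₀ = C * 19 ^ C * 2 ^ (64 * C) := ⟨_, rfl⟩
  refine ⟨c₀ + (2 * C + 6), fun n N w W hn hN hw hwn hW => ?_⟩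
  set Y := 2 ^ (6 * w) with hY
  set Z := (n + 1) ^ Y with hZ
  have hYpos : 0 < Y := by positivity
  have hYZ : Y ≤ Z := (Nat.lt_pow_self (by omega)).le
  have hnZ : n + 1 ≤ Z := Nat.le_self_pow hYpos.ne' _
  have h₁ : 8 * (n + N + 1) + Y + Z + 1 ≤ 19 * N * Z := by
    have a₁ : N ≤ N * Z := Nat.le_mul_of_pos_right _ (by omega)
    have a₂ : Z ≤ N * Z := Nat.le_mul_of_pos_left _ hN
    rw [mul_assoc]
    omega
  -- For a single vertex, the power of `n` is trivial, but then `w = 1`.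
  have h₂ : Z ^ C ≤ 2 ^ (64 * C) * n ^ 2 ^ ((c₀ + (2 * C + 6)) * W) := by
    rcases Nat.lt_or_ge 1 n with hn2 | hn1
    · have b₁ : n + 1 ≤ n ^ 2 := by nlinarith
      have b₂ : 2 * (Y * C) ≤ 2 ^ ((c₀ + (2 * C + 6)) * W) := by
        calc 2 * (Y * C) = 2 * C * Y := by ring
          _ ≤ 2 ^ (2 * C) * Y := Nat.mul_le_mul_right _ Nat.lt_two_pow_self.le
          _ = 2 ^ (2 * C + 6 * w) := by rw [hY, ← pow_add]
          _ ≤ _ := by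
            refine Nat.pow_le_pow_right (by omega) ?_
            have d₁ : 2 * C ≤ 2 * C * W := Nat.le_mul_of_pos_right _ (by omega)
            have d₂ : 6 * w ≤ 6 * W := by omega
            calc 2 * C + 6 * w ≤ (2 * C + 6) * W := by rw [add_mul]; omega
              _ ≤ _ := Nat.mul_le_mul_right _ (by omega)
      calc Z ^ C = (n + 1) ^ (Y * C) := (pow_mul _ _ _).symm
        _ ≤ (n ^ 2) ^ (Y * C) := Nat.pow_le_pow_left b₁ _
        _ = n ^ (2 * (Y * C)) := (pow_mul _ _ _).symm
        _ ≤ n ^ 2 ^ ((c₀ + (2 * C + 6)) * W) := Nat.pow_le_pow_right hn b₂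
        _ ≤ _ := Nat.le_mul_of_pos_left _ (by positivity)
    · obtain rfl : n = 1 := by omega
      obtain rfl : w = 1 := by omega
      rw [one_pow, mul_one, hZ, ← pow_mul, hY]
      norm_num
  calc C * (8 * (n + N + 1) + Y + Z + 1) ^ C ≤ C * (19 * N * Z) ^ C :=
        Nat.mul_le_mul_left _ (Nat.pow_le_pow_left h₁ _)
    _ = C * 19 ^ C * N ^ C * Z ^ C := by rw [mul_pow, mul_pow]; ring
    _ ≤ C * 19 ^ C * N ^ (c₀ + (2 * C + 6)) *
        (2 ^ (64 * C) * n ^ 2 ^ ((c₀ + (2 * C + 6)) * W)) :=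
        Nat.mul_le_mul (Nat.mul_le_mul_left _ (Nat.pow_le_pow_right hN (by omega))) h₂
    _ = c₀ * N ^ (c₀ + (2 * C + 6)) * n ^ 2 ^ ((c₀ + (2 * C + 6)) * W) := by rw [hc₀]; ring
    _ ≤ _ := Nat.mul_le_mul_right _ (Nat.mul_le_mul_right _ (by omega))

end Input

end FallRam

theorem mainTheorem3 :
    ∃ (P : RamProg) (c : ℕ), ∀ (n N : ℕ) (G : SimpleGraph (Fin n))
      (D : RootedBranchDecomposition (Fin n) (Fin N)) (k : ℕ),
      ∃ (σ : RamStore) (t : ℕ),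
        P.Runs (fallColInput G D k) σ t ∧
        t ≤ c * N ^ c * n ^ (2 ^ (c * D.moduleWidth G)) ∧
        (HasFallColoring G k → σ 0 0 = 1) ∧
        (¬ HasFallColoring G k → σ 0 0 = 0) := by
  obtain ⟨P, C, hP⟩ := FallRam.stage_final
  obtain ⟨c, hc⟩ := FallRam.exists_time_le C
  refine ⟨P, c, fun n N G D k => ?_⟩
  obtain ⟨-, σ, t, hr, ht, hσ⟩ := hP (fallColInput G D k) _ trivial ⟨fun _ _ => rfl, rfl⟩
  have hout : σ 0 0 = FallRam.ind (HasFallColoring G k) := by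
    rw [hσ.1 0 (by omega), FallRam.final_fallColInput]
  rw [FallRam.final_bound, FallRam.fallColInput_bound] at ht
  exact ⟨σ, t, hr, ht.trans (hc _ _ _ _ (FallRam.input_pos D) D.tree.root.pos
    (FallRam.input_width_pos G D k) FallRam.Inst.width_le (FallRam.input_width_le G D k)),
    fun h => hout.trans (FallRam.ind_of h), fun h => hout.trans (FallRam.ind_of_not h)⟩
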